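/- Let $I$ and $O$ be finite sets, let $\Lambda=(\lambda_{ij})_{i,j\in I}$ be a rate transition matrix ($\lambda_{ij}\ge 0$ for $i\ne j$, $\sum_{j}\lambda_{ij}=0$ for all $i$), and let $h:I\to O$ be surjective. Let $\Delta$ be the set of probability vectors $\mu=(\mu(i))_{i\in I}$, regarded as row vectors. Let $\Omega$ be the set of cadlag functions $\omega:[0,\infty)\to I$, with $X_t(\omega)=\omega(t)$, $Y_t=h(X_t)$, $\mathcal F^0=\sigma(X_s:s\ge 0)$, $\mathcal F^0_t=\sigma(X_s:s\in[0,t])$ and $\mathcal Y^0_t=\sigma(Y_s:s\in[0,t])$. For $\mu\in\Delta$ let $P_\mu$ be the unique probability measure on $(\Omega,\mathcal F^0)$ under which $X$ is a Markov process with generator $\Lambda$ and initial distribution $\mu$, i.e. $P_\mu(X_0=i)=\mu(i)$ for $i\in I$, and $E_\mu[f(X_{t+s})\,|\,\mathcal F^0_t]=(e^{s\Lambda}f)(X_t)$ $P_\mu$-a.s. for all $t,s\ge 0$ and $f:I\to\mathbb R$. Write $P_i$ for $P_\mu$ when $\mu$ is the Dirac mass at $i$. For $a\in O$ and a row vector $v$,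 let $1_{h^{-1}(a)}\ast v$ be the restriction of $v$ to $h^{-1}(a)$ (the other components being set to $0$), and let $v1_{h^{-1}(a)}=\sum_{j:\,h(j)=a}v(j)$. Fix, for each $a\in O$, an arbitrary probability vector $\nu_a$ supported in $h^{-1}(a)$, and set $H_a[v]=\frac{1}{v1_{h^{-1}(a)}}\,1_{h^{-1}(a)}\ast v$ if $v1_{h^{-1}(a)}\ne 0$, and $H_a[v]=\nu_a$ otherwise. For $\mu\in\Delta$ and $\omega\in\Omega$ let $t\mapsto\Pi^\mu_t(\omega)\in\mathbb R^I$ be the unique cadlag solution of the filtering equation $$ \Pi^\mu_t=H_{Y_0}[\mu]+\int_0^t\Big\{1_{h^{-1}(Y_s)}\ast(\Pi^\mu_s\Lambda)-(\Pi^\mu_s\Lambda 1_{h^{-1}(Y_s)})\,\Pi^\mu_s\Big\}\,ds+\sum_{0<T_n\le t}\Big\{H_{Y_{T_n}}[\Pi^\mu_{T_n-}\Lambda]-\Pi^\mu_{T_n-}\Big\},\qquad t\ge 0, $$ where $T_1<T_2<\cdots$ are the jump times of $s\mapsto Y_s(\omega)$. Then for every $\mu\in\Delta$, $t\ge 0$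 and $\Gamma\in\mathcal F^0$, $$ P_\mu\big(X_{t+\cdot}\in\Gamma\,\big|\,\mathcal Y^0_t\big)=P_{\Pi^\mu_t}(\Gamma):=\sum_{i\in I}P_i(\Gamma)\,\Pi^\mu_t(i),\qquad P_\mu\text{-a.s.} $$ -/

import Mathlib

open MeasureTheory ProbabilityTheory Filter Topology Set
open scoped NNReal Matrix

/-- Rate transition matrices (Q-matrices) on `I`. -/
structure IsRateMatrix {I : Type*} [Fintype I] (Λ : Matrix I I ℝ) : Prop where
  off_diag_nonneg : ∀ i j, i ≠ j → 0 ≤ Λ i j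
  row_sum : ∀ i, ∑ j, Λ i j = 0

/-- The canonical space of cadlag functions `ω : [0,∞) → I`. Since `I` is a finite set with the
discrete topology, right continuity at `t` means that `ω` is constant on some `[t, t + ε)`, and a
left limit at `t > 0` exists when `ω` is constant on some `(t - ε, t)`. -/
def CadlagPath (I : Type*) : Type _ :=
  {ω : ℝ≥0 → I // (∀ t, ∀ᶠ s in 𝓝[≥] t, ω s = ω t) ∧
    ∀ t, 0 < t → ∃ i, ∀ᶠ s in 𝓝[<] t, ω s = i}

namespace CadlagPath

variable {I O : Type*}

/-- The coordinate process `X_t(ω) = ω(t)`. -/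
def X (t : ℝ≥0) (ω : CadlagPath I) : I := ω.1 t

/-- The observation process `Y_t = h(X_t)`. -/
def Y (h : I → O) (t : ℝ≥0) (ω : CadlagPath I) : O := h (X t ω)

/-- The σ-algebra `σ(X_s : s ≥ 0)`; the finite set `I` carries all its subsets. -/
instance instMeasurableSpace : MeasurableSpace (CadlagPath I) :=
  ⨆ s : ℝ≥0, MeasurableSpace.comap (X s) ⊤

/-- `σ(X_s : s ∈ [0,t])`. -/
@[reducible] def chainSigma (I : Type*) (t : ℝ≥0) : MeasurableSpace (CadlagPath I) :=
  ⨆ s ∈ Icc (0 : ℝ≥0) t, MeasurableSpace.comap (X s) ⊤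

/-- `σ(Y_s : s ∈ [0,t])`. -/
@[reducible] def obsSigma (h : I → O) (t : ℝ≥0) : MeasurableSpace (CadlagPath I) :=
  ⨆ s ∈ Icc (0 : ℝ≥0) t, MeasurableSpace.comap (Y h s) ⊤

/-- The shifted path `X_{t+·}(ω)`, that is `s ↦ ω(t + s)`. -/
def shift (t : ℝ≥0) (ω : CadlagPath I) : CadlagPath I :=
  ⟨fun s => ω.1 (t + s), by
    refine ⟨fun s => ?_, fun s hs => ?_⟩
    · have hT : Tendsto (fun r : ℝ≥0 => t + r) (𝓝[≥] s) (𝓝[≥] (t + s)) := by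
        refine tendsto_nhdsWithin_iff.2 ⟨?_, ?_⟩
        · exact ((continuous_const.add continuous_id).tendsto s).mono_left nhdsWithin_le_nhds
        · filter_upwards [self_mem_nhdsWithin] with r hr
          exact add_le_add_right (mem_Ici.1 hr) t
      exact hT.eventually (ω.2.1 (t + s))
    · obtain ⟨i, hi⟩ := ω.2.2 (t + s) (by positivity)
      have hT : Tendsto (fun r : ℝ≥0 => t + r) (𝓝[<] s) (𝓝[<] (t + s)) := by
        refine tendsto_nhdsWithin_iff.2 ⟨?_, ?_⟩
        · exact ((continuous_const.add continuous_id).tendsto s).mono_left nhdsWithin_le_nhds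
        · filter_upwards [self_mem_nhdsWithin] with r hr
          exact add_lt_add_right (mem_Iio.1 hr) t
      exact ⟨i, hT.eventually hi⟩⟩

/-- The set `{T_n : n ≥ 1, T_n < ∞}` of jump times of the trajectory `s ↦ Y_s(ω)`: the times
`s > 0` at which `Y_s(ω)` differs from the left limit of `Y` at `s`. -/
def jumpTimes (h : I → O) (ω : CadlagPath I) : Set ℝ≥0 :=
  {s | 0 < s ∧ ¬ ∀ᶠ r in 𝓝[<] s, Y h r ω = Y h s ω}

end CadlagPath

open CadlagPath

/-- `P` is the probability on path space under which the coordinate process is a Markov process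
with generator `Λ` and initial distribution `μ`. -/
structure IsChainLaw {I : Type*} [Fintype I] [DecidableEq I] (Λ : Matrix I I ℝ)
    (μ : stdSimplex ℝ I) (P : Measure (CadlagPath I)) : Prop where
  isProbabilityMeasure : IsProbabilityMeasure P
  initial : ∀ i, P.real {ω | X 0 ω = i} = μ.1 i
  markov : ∀ (t s : ℝ≥0) (f : I → ℝ),
    P[fun ω => f (X (t + s) ω) | chainSigma I t] =ᵐ[P]
      fun ω => (NormedSpace.exp ((s : ℝ) • Λ) *ᵥ f) (X t ω)

/-- The Dirac mass at `i`, as a point of the simplex. -/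
def diracPt {I : Type*} [Fintype I] [DecidableEq I] (i : I) : stdSimplex ℝ I :=
  ⟨Pi.single i 1, single_mem_stdSimplex ℝ i⟩

section Filtering

variable {I O : Type*} [Fintype I]

/-- `1_{h⁻¹(a)} ∗ v`, the restriction of the row vector `v` to the level set `h⁻¹(a)`. -/
noncomputable def restr (h : I → O) (a : O) (v : I → ℝ) : I → ℝ := (h ⁻¹' {a}).indicator v

/-- `v 1_{h⁻¹(a)}`, the total mass of the row vector `v` on the level set `h⁻¹(a)`. -/
noncomputable def levelMass (h : I → O) (a : O) (v : I → ℝ) : ℝ := ∑ i, restr h a v i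

open Classical in
/-- The operator `H_a`; `ν a` is its value on the vectors without mass on `h⁻¹(a)`. -/
noncomputable def opH (h : I → O) (ν : O → I → ℝ) (a : O) (v : I → ℝ) : I → ℝ :=
  if levelMass h a v = 0 then ν a else (levelMass h a v)⁻¹ • restr h a v

/-- The vector field `F_a(y) = 1_{h⁻¹(a)} ∗ (yΛ) - (yΛ 1_{h⁻¹(a)}) y`. -/
noncomputable def filterField (Λ : Matrix I I ℝ) (h : I → O) (a : O) (y : I → ℝ) : I → ℝ :=
  restr h a (y ᵥ* Λ) - levelMass h a (y ᵥ* Λ) • y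

/-- `p` is a cadlag solution of the filtering equation driven by the trajectory `Y(ω)`, with
initial condition `H_{Y_0(ω)}[μ]`. -/
structure IsFilterSolution (Λ : Matrix I I ℝ) (h : I → O) (ν : O → I → ℝ)
    (μ : stdSimplex ℝ I) (ω : CadlagPath I) (p : ℝ≥0 → I → ℝ) : Prop where
  right_cont : ∀ t, ContinuousWithinAt p (Ici t) t
  left_lim : ∀ t, 0 < t → ∃ l, Tendsto p (𝓝[<] t) (𝓝 l)
  equation : ∀ t i, p t i = opH h ν (Y h 0 ω) μ.1 i
    + (∫ s in (0 : ℝ)..t, filterField Λ h (Y h s.toNNReal ω) (p s.toNNReal) i)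
    + ∑ᶠ s ∈ jumpTimes h ω ∩ Iic t,
        (opH h ν (Y h s ω) (Function.leftLim p s ᵥ* Λ) i - Function.leftLim p s i)

/-- The filtering process `Π^μ_t(ω)`: the solution of the filtering equation. -/
noncomputable def filteringProcess (Λ : Matrix I I ℝ) (h : I → O) (ν : O → I → ℝ)
    (μ : stdSimplex ℝ I) (t : ℝ≥0) (ω : CadlagPath I) : I → ℝ :=
  Classical.epsilon (fun p : ℝ≥0 → I → ℝ => IsFilterSolution Λ h ν μ ω p) t

end Filtering

/-!
The filter is computed first for a chain observed on a grid of mesh `δ`, where Bayes' formula is a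
finite computation, and then the mesh is sent to `0`.

*Observations on a grid.* Write `E = exp (δ Λ)`. By the Markov property the joint law of
`Y_0, Y_δ, …, Y_{kδ}` and `X_{kδ}` is given by the vector `obsVec`, which is obtained from `μ` by
alternately applying `E` and restricting to the level set of the next observation
(`IsChainLaw.real_obs_inter`). Its normalisation `gridFilter` is therefore the conditional law of
`X_{kδ}` (`IsChainLaw.condExp_gridObs`).

*Refinement, probabilistic side.* Along dyadic subdivisions of `[0, t]` the σ-algebras generated by
the grid observations increase to `σ(Y_s : s ≤ t)`, because `Y` is right continuous. Lévy's upward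
theorem gives the almost sure convergence of the grid filters to the conditional law of `X_t`.

*Refinement, pathwise side.* While `Y` stays equal to `a`, one step of the grid multiplies the
unnormalised filter by `1 + δ B + o(δ)`, where `B` is the block of `Λ` on `h⁻¹(a)`, so that many
steps converge to `exp (τ B)` (`tendsto_pow_exp`). At a jump of `Y` to `b` the step is
`δ 1_{h⁻¹(b)} ∗ (· Λ) + o(δ)`, and the factor `δ` disappears in the normalisation. The limit
follows the vector field of the filtering equation between the jumps of `Y` and makes the prescribed
jumps, hence it solves the filtering equation (`IsRegularPath.exists_isFilterSolution`). The
solution is unique because the vector field is locally Lipschitz (`IsFilterSolution.eq`), so the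
limit is the filtering process.

*Null sets.* The pathwise argument needs the normalising constants not to vanish. It is carried out
for the paths whose initial point is charged by `μ` and whose jumps `i → j` all satisfy
`0 < Λ i j`; along them the filter always charges the current position of the chain. Almost every
path is of this kind (`IsChainLaw.ae_isRegularPath`).

*Events of the future.* The law of the whole future follows from the conditional law of the present
state by the Markov property, extended from one-dimensional marginals to path space by a π-system
argument (`IsChainLaw.real_inter_shift`), and by the tower property
(`IsChainLaw.condExp_shift_obsSigma`).

Properties at all times of a path are obtained from `CadlagPath.path_induction`, which moves from
`S` to `S'` when the path is constant on `[S, S')`.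
-/

/-! ### Matrix exponentials -/

section BanachAlgebra

variable {A : Type*} [NormedRing A]

lemma norm_pow_sub_pow_le [NormOneClass A] {x y : A} {r : ℝ} (hr : 1 ≤ r) (hx : ‖x‖ ≤ r)
    (hy : ‖y‖ ≤ r) (m : ℕ) : ‖x ^ m - y ^ m‖ ≤ m * r ^ m * ‖x - y‖ := by
  induction m with
  | zero => simp
  | succ m ih =>
    have hr0 : 0 ≤ r := zero_le_one.trans hr
    have hxm : ‖x ^ m‖ ≤ r ^ m := (norm_pow_le x m).trans (by gcongr)
    have e : x ^ (m + 1) - y ^ (m + 1) = x ^ m * (x - y) + (x ^ m - y ^ m) * y := by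
      rw [pow_succ, pow_succ, mul_sub, sub_mul]; abel
    calc ‖x ^ (m + 1) - y ^ (m + 1)‖ ≤ ‖x ^ m‖ * ‖x - y‖ + ‖x ^ m - y ^ m‖ * ‖y‖ := by
          rw [e]; exact (norm_add_le _ _).trans (add_le_add (norm_mul_le _ _) (norm_mul_le _ _))
      _ ≤ r ^ (m + 1) * ‖x - y‖ + (m * r ^ m * ‖x - y‖) * r := by
          gcongr
          exact hxm.trans (pow_le_pow_right₀ hr (Nat.le_succ m))
      _ = ((m + 1 : ℕ) : ℝ) * r ^ (m + 1) * ‖x - y‖ := by push_cast; ring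

/-- Powers of one-step matrices that are accurate to first order converge to the exponential:
the product form of Euler's scheme. -/
lemma tendsto_pow_exp [NormOneClass A] [NormedAlgebra ℝ A] [CompleteSpace A] {ι : Type*}
    {l : Filter ι} {M : ι → A} {δ : ι → ℝ} {m : ι → ℕ} {B : A} {τ : ℝ} (hpos : ∀ᶠ n in l, 0 < δ n)
    (hδ : Tendsto δ l (𝓝 0)) (hM : Tendsto (fun n => (δ n)⁻¹ • (M n - 1)) l (𝓝 B))
    (hm : Tendsto (fun n => m n * δ n) l (𝓝 τ)) :
    Tendsto (fun n => M n ^ m n) l (𝓝 (NormedSpace.exp (τ • B))) := by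
  let _ : NormedAlgebra ℚ A := NormedAlgebra.restrictScalars ℚ ℝ A
  have hne : ∀ᶠ n in l, δ n ≠ 0 := hpos.mono fun n hn => hn.ne'
  have hδ' : Tendsto δ l (𝓝[≠] 0) := tendsto_nhdsWithin_iff.2 ⟨hδ, hne⟩
  have hexp : Tendsto (fun n => (δ n)⁻¹ • (NormedSpace.exp (δ n • B) - 1)) l (𝓝 B) := by
    have h := (hasDerivAt_exp_smul_const (𝕂 := ℝ) B 0)
    simp only [zero_smul, NormedSpace.exp_zero, one_mul] at h
    have := (hasDerivAt_iff_tendsto_slope.1 h).comp hδ'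
    refine this.congr fun n => ?_
    simp [slope_def_module, NormedSpace.exp_zero]
  have hbd : ∀ N : ι → A, Tendsto (fun n => (δ n)⁻¹ • (N n - 1)) l (𝓝 B) →
      ∀ᶠ n in l, ‖N n‖ ≤ Real.exp ((‖B‖ + 1) * δ n) := by
    intro N hN
    filter_upwards [hpos, hN.norm.eventually_lt_const (lt_add_one ‖B‖)] with n hn hN
    rw [norm_smul, norm_inv, Real.norm_of_nonneg hn.le, inv_mul_lt_iff₀ hn] at hN
    calc ‖N n‖ = ‖(N n - 1) + 1‖ := by rw [sub_add_cancel]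
      _ ≤ ‖N n - 1‖ + ‖(1 : A)‖ := norm_add_le _ _
      _ ≤ (‖B‖ + 1) * δ n + 1 := by rw [norm_one]; linarith
      _ ≤ _ := Real.add_one_le_exp _
  have hdiff : Tendsto (fun n => ‖(δ n)⁻¹ • (M n - NormedSpace.exp (δ n • B))‖) l (𝓝 0) := by
    have := (hM.sub hexp).norm
    rw [sub_self, norm_zero] at this
    refine this.congr fun n => ?_
    rw [← smul_sub, sub_sub_sub_cancel_right]
  have hlim : Tendsto (fun n => (m n * δ n) * Real.exp ((‖B‖ + 1) * (m n * δ n)) *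
      ‖(δ n)⁻¹ • (M n - NormedSpace.exp (δ n • B))‖) l (𝓝 0) := by
    have h2 := (Real.continuous_exp.tendsto _).comp (hm.const_mul (‖B‖ + 1))
    simpa using (hm.mul h2).mul hdiff
  -- `m ‖M - exp (δ B)‖ = (m δ) ‖δ⁻¹ (M - exp (δ B))‖`, and the norms of the powers stay bounded.
  have hz : Tendsto (fun n => M n ^ m n - NormedSpace.exp (δ n • B) ^ m n) l (𝓝 0) := by
    refine squeeze_zero_norm' ?_ hlim
    filter_upwards [hpos, hbd M hM, hbd _ hexp] with n hn h1 h2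
    refine (norm_pow_sub_pow_le (Real.one_le_exp (by positivity)) h1 h2 (m n)).trans (le_of_eq ?_)
    rw [norm_smul, norm_inv, Real.norm_of_nonneg hn.le, ← Real.exp_nat_mul]
    field_simp
  have hE : Tendsto (fun n => NormedSpace.exp (δ n • B) ^ m n) l
      (𝓝 (NormedSpace.exp (τ • B))) := by
    have := (NormedSpace.exp_continuous (𝔸 := A)).tendsto (τ • B) |>.comp (hm.smul_const B)
    refine this.congr fun n => ?_
    simp only [Function.comp]
    rw [← NormedSpace.exp_nsmul, ← Nat.cast_smul_eq_nsmul ℝ, smul_smul]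
  simpa using hz.add hE

end BanachAlgebra

section MatrixExp

variable {I : Type*} [Fintype I] [DecidableEq I]

open scoped Matrix.Norms.Operator

lemma matrix_tendsto_pow_exp [Nonempty I] {ι : Type*} {l : Filter ι} {M : ι → Matrix I I ℝ}
    {δ : ι → ℝ} {m : ι → ℕ} {B : Matrix I I ℝ} {τ : ℝ} (hpos : ∀ᶠ n in l, 0 < δ n)
    (hδ : Tendsto δ l (𝓝 0)) (hM : Tendsto (fun n => (δ n)⁻¹ • (M n - 1)) l (𝓝 B))
    (hm : Tendsto (fun n => m n * δ n) l (𝓝 τ)) :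
    Tendsto (fun n => M n ^ m n) l (𝓝 (NormedSpace.exp (τ • B))) := by
  exact tendsto_pow_exp hpos hδ hM hm

lemma matrix_hasDerivAt_exp (B : Matrix I I ℝ) (t : ℝ) :
    HasDerivAt (fun s : ℝ => NormedSpace.exp (s • B)) (NormedSpace.exp (t • B) * B) t := by
  exact hasDerivAt_exp_smul_const B t

lemma matrix_tendsto_exp_sub_one (B : Matrix I I ℝ) :
    Tendsto (fun δ : ℝ≥0 => (δ : ℝ)⁻¹ • (NormedSpace.exp ((δ : ℝ) • B) - 1)) (𝓝[>] 0) (𝓝 B) := by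
  have h := matrix_hasDerivAt_exp B 0
  simp only [zero_smul, NormedSpace.exp_zero, one_mul] at h
  have hδ : Tendsto (fun δ : ℝ≥0 => (δ : ℝ)) (𝓝[>] 0) (𝓝[≠] 0) := by
    refine tendsto_nhdsWithin_iff.2 ⟨?_, ?_⟩
    · exact (NNReal.continuous_coe.tendsto 0).mono_left nhdsWithin_le_nhds
    · filter_upwards [self_mem_nhdsWithin] with δ hδ
      exact NNReal.coe_ne_zero.2 (ne_of_gt hδ)
  refine ((hasDerivAt_iff_tendsto_slope.1 h).comp hδ).congr fun n => ?_
  simp [slope_def_module, NormedSpace.exp_zero]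

/-- The first two terms of the exponential series bound it from below. -/
lemma exp_apply_ge_of_nonneg {N : Matrix I I ℝ} (hN : ∀ i j, 0 ≤ N i j) (i j : I) :
    (1 + N) i j ≤ NormedSpace.exp N i j := by
  have hs : HasSum (fun n : ℕ => ((n.factorial : ℝ)⁻¹ • N ^ n : Matrix I I ℝ))
      (NormedSpace.exp N) := NormedSpace.exp_series_hasSum_exp' (𝕂 := ℝ) N
  have hs' : HasSum (fun n : ℕ => ((n.factorial : ℝ)⁻¹ • N ^ n : Matrix I I ℝ) i j)
      (NormedSpace.exp N i j) := by
    exact (Pi.hasSum.1 (Pi.hasSum.1 hs i) j)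
  have hpow : ∀ n : ℕ, ∀ i j, 0 ≤ (N ^ n) i j := by
    intro n
    induction n with
    | zero => intro i j; rw [pow_zero, Matrix.one_apply]; split_ifs <;> norm_num
    | succ n ih =>
      intro i j
      rw [pow_succ, Matrix.mul_apply]
      exact Finset.sum_nonneg fun k _ => mul_nonneg (ih i k) (hN k j)
  have := sum_le_hasSum (Finset.range 2) (fun n _ => ?_) hs'
  · simpa [Finset.sum_range_succ] using this
  · exact mul_nonneg (by positivity) (hpow n i j)

/-- Shifting a Metzler matrix by a multiple of the identity makes it entrywise nonnegative, which
bounds its exponential from below. -/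
lemma exists_le_exp_smul {B : Matrix I I ℝ} (hB : ∀ i j, i ≠ j → 0 ≤ B i j) :
    ∃ c : ℝ, 0 ≤ c ∧ (∀ i, 0 ≤ B i i + c) ∧ ∀ τ : ℝ, 0 ≤ τ → ∀ i j,
      Real.exp (-(τ * c)) * (1 + τ • (B + c • 1)) i j ≤ NormedSpace.exp (τ • B) i j := by
  refine ⟨∑ i, |B i i|, by positivity, fun i => ?_, fun τ hτ i j => ?_⟩
  · have := Finset.single_le_sum (f := fun i => |B i i|) (fun i _ => abs_nonneg _)
      (Finset.mem_univ i)
    linarith [neg_abs_le (B i i)]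
  · set c := ∑ i, |B i i| with hc
    have hN : ∀ i j, 0 ≤ (τ • (B + c • (1 : Matrix I I ℝ))) i j := by
      intro i j
      refine mul_nonneg hτ ?_
      rcases eq_or_ne i j with rfl | hij
      · have := Finset.single_le_sum (f := fun i => |B i i|) (fun i _ => abs_nonneg _)
          (Finset.mem_univ i)
        simp only [Matrix.add_apply, Matrix.smul_apply, Matrix.one_apply_eq, smul_eq_mul, mul_one]
        linarith [neg_abs_le (B i i)]
      · simpa [Matrix.one_apply, hij] using hB i j hij
    have e : NormedSpace.exp (τ • B) =
        Real.exp (-(τ * c)) • NormedSpace.exp (τ • (B + c • (1 : Matrix I I ℝ))) := by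
      have e1 : τ • B = (-(τ * c)) • (1 : Matrix I I ℝ) + τ • (B + c • 1) := by
        ext i j; simp; ring
      rw [e1, Matrix.exp_add_of_commute _ _ ((Commute.one_left _).smul_left _)]
      have : NormedSpace.exp ((-(τ * c)) • (1 : Matrix I I ℝ)) =
          Real.exp (-(τ * c)) • (1 : Matrix I I ℝ) := by
        rw [Matrix.smul_one_eq_diagonal, Matrix.exp_diagonal, Matrix.smul_one_eq_diagonal]
        congr 1
        ext i
        rw [Pi.coe_exp, Real.exp_eq_exp_ℝ]
      rw [this, smul_mul_assoc, one_mul]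
    rw [e]
    exact mul_le_mul_of_nonneg_left (exp_apply_ge_of_nonneg hN i j) (Real.exp_pos _).le

lemma exp_smul_apply_nonneg {B : Matrix I I ℝ} (hB : ∀ i j, i ≠ j → 0 ≤ B i j) {τ : ℝ}
    (hτ : 0 ≤ τ) (i j : I) : 0 ≤ NormedSpace.exp (τ • B) i j := by
  obtain ⟨c, -, hd, hle⟩ := exists_le_exp_smul hB
  refine le_trans (mul_nonneg (Real.exp_pos _).le ?_) (hle τ hτ i j)
  rcases eq_or_ne i j with rfl | hij
  · have := mul_nonneg hτ (hd i)
    simp only [Matrix.add_apply, Matrix.smul_apply, Matrix.one_apply_eq, smul_eq_mul, mul_one]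
    linarith
  · simpa [Matrix.one_apply, hij] using mul_nonneg hτ (hB i j hij)

/-- The exponential of a Metzler matrix charges the diagonal and every positive entry. -/
lemma exp_smul_apply_pos {B : Matrix I I ℝ} (hB : ∀ i j, i ≠ j → 0 ≤ B i j) {τ : ℝ}
    (hτ : 0 < τ) {i j : I} (hij : i = j ∨ 0 < B i j) : 0 < NormedSpace.exp (τ • B) i j := by
  obtain ⟨c, -, hd, hle⟩ := exists_le_exp_smul hB
  refine lt_of_lt_of_le (mul_pos (Real.exp_pos _) ?_) (hle τ hτ.le i j)
  rcases eq_or_ne i j with rfl | hne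
  · have := mul_nonneg hτ.le (hd i)
    simp only [Matrix.add_apply, Matrix.smul_apply, Matrix.one_apply_eq, smul_eq_mul, mul_one]
    linarith
  · have := mul_pos hτ (hij.resolve_left hne)
    simpa [Matrix.one_apply, hne] using this

end MatrixExp

/-! ### Cadlag paths and induction along them -/

section Paths

variable {I O : Type*}

lemma nnreal_nhdsLT_neBot {s : ℝ≥0} (hs : 0 < s) : (𝓝[<] s).NeBot :=
  nhdsLT_neBot_of_exists_lt ⟨0, hs⟩

lemma CadlagPath.exists_const_right (ω : CadlagPath I) (s : ℝ≥0) :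
    ∃ u, s < u ∧ ∀ r ∈ Ico s u, X r ω = X s ω := by
  obtain ⟨u, hu, hsub⟩ := mem_nhdsGE_iff_exists_Ico_subset.1 (ω.2.1 s)
  exact ⟨u, hu, fun r hr => hsub hr⟩

lemma CadlagPath.exists_const_left (ω : CadlagPath I) {s : ℝ≥0} (hs : 0 < s) :
    ∃ S, S < s ∧ ∀ S' ∈ Ico S s, ∀ r ∈ Ico S' s, X r ω = X S' ω := by
  obtain ⟨i, hi⟩ := ω.2.2 s hs
  obtain ⟨l, hl, hsub⟩ := (mem_nhdsLT_iff_exists_Ioo_subset' hs).1 hi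
  obtain ⟨S, hS1, hS2⟩ := exists_between (mem_Iio.1 hl)
  have hval : ∀ r, S ≤ r → r < s → X r ω = i := fun r h1 h2 => hsub ⟨hS1.trans_le h1, h2⟩
  refine ⟨S, hS2, fun S' hS' r hr => ?_⟩
  rw [hval S' hS'.1 hS'.2, hval r (hS'.1.trans hr.1) hr.2]

/-- Induction along a cadlag path: a property that holds at time `0` and is propagated from `S`
to `S'` whenever the path is constant on `[S, S')` holds at all times. This avoids an explicit
enumeration of the jump times. -/
lemma CadlagPath.path_induction (ω : CadlagPath I) {G : ℝ≥0 → Prop} (h0 : G 0)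
    (step : ∀ S S', S < S' → (∀ r ∈ Ico S S', X r ω = X S ω) → G S → G S') (t : ℝ≥0) : G t := by
  set A : Set ℝ≥0 := {s | s ≤ t ∧ G s} with hA
  have hne : A.Nonempty := ⟨0, zero_le, h0⟩
  have hbd : BddAbove A := ⟨t, fun s hs => hs.1⟩
  set c := sSup A with hc
  have hct : c ≤ t := csSup_le hne fun s hs => hs.1
  have hcG : G c := by
    by_contra hcG
    have hc0 : 0 < c := by
      rw [pos_iff_ne_zero]
      intro h
      exact hcG (h ▸ h0)
    obtain ⟨S, hS, hconst⟩ := ω.exists_const_left hc0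
    obtain ⟨r, hrA, hr⟩ := exists_lt_of_lt_csSup hne hS
    have hrc : r < c := lt_of_le_of_ne (le_csSup hbd hrA) fun h => hcG (h ▸ hrA.2)
    exact hcG (step r c hrc (hconst r ⟨hr.le, hrc⟩) hrA.2)
  rcases hct.eq_or_lt with h | h
  · exact h ▸ hcG
  · obtain ⟨u, hu, hconst⟩ := ω.exists_const_right c
    obtain ⟨r, hr1, hr2⟩ := exists_between (lt_min h hu)
    have hrG : G r := step c r hr1
      (fun x hx => hconst x ⟨hx.1, hx.2.trans (hr2.trans_le (min_le_right _ _))⟩) hcG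
    exact absurd (le_csSup hbd ⟨(hr2.trans_le (min_le_left _ _)).le, hrG⟩) (not_le.2 hr1)

lemma mem_jumpTimes_of_const {h : I → O} {ω : CadlagPath I} {S S' : ℝ≥0} (hSS : S < S')
    (hc : ∀ r ∈ Ico S S', X r ω = X S ω) :
    S' ∈ jumpTimes h ω ↔ Y h S' ω ≠ Y h S ω := by
  have hev : ∀ᶠ r in 𝓝[<] S', Y h r ω = Y h S ω := by
    filter_upwards [Ico_mem_nhdsLT hSS] with r hr
    rw [Y, Y, hc r hr]
  have := nnreal_nhdsLT_neBot (zero_le.trans_lt hSS)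
  constructor
  · intro hj he
    exact hj.2 (by rwa [he])
  · intro hne
    refine ⟨zero_le.trans_lt hSS, fun hev' => hne ?_⟩
    obtain ⟨r, h1, h2⟩ := (hev.and hev').exists
    exact h2.symm.trans h1

lemma jumpTimes_inter_Iic_of_const {h : I → O} {ω : CadlagPath I} {S S' : ℝ≥0} (hSS : S < S')
    (hc : ∀ r ∈ Ico S S', X r ω = X S ω) :
    jumpTimes h ω ∩ Iic S' = {s | s = S' ∧ Y h S' ω ≠ Y h S ω} ∪ (jumpTimes h ω ∩ Iic S) := by
  ext s
  simp only [mem_inter_iff, mem_Iic, mem_union, mem_ofPred_eq]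
  constructor
  · rintro ⟨hj, hs⟩
    rcases le_or_gt s S with hsS | hsS
    · exact Or.inr ⟨hj, hsS⟩
    · have hc' : ∀ r ∈ Ico S s, X r ω = X S ω := fun r hr => hc r ⟨hr.1, hr.2.trans_le hs⟩
      have hne := (mem_jumpTimes_of_const hsS hc').1 hj
      rcases hs.eq_or_lt with rfl | hlt
      · exact Or.inl ⟨rfl, hne⟩
      · exact absurd (by rw [Y, Y, hc s ⟨hsS.le, hlt⟩]) hne
  · rintro (⟨rfl, hne⟩ | ⟨hj, hs⟩)
    · exact ⟨(mem_jumpTimes_of_const hSS hc).2 hne, le_rfl⟩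
    · exact ⟨hj, hs.trans hSS.le⟩

lemma finite_jumpTimes_inter_Iic (h : I → O) (ω : CadlagPath I) (t : ℝ≥0) :
    (jumpTimes h ω ∩ Iic t).Finite := by
  refine ω.path_induction (G := fun t => (jumpTimes h ω ∩ Iic t).Finite) ?_ ?_ t
  · refine Set.finite_empty.subset ?_
    rintro s ⟨hj, hs⟩
    exact absurd hj.1 (not_lt.2 hs)
  · intro S S' hSS hc hS
    rw [jumpTimes_inter_Iic_of_const hSS hc]
    exact ((Set.finite_singleton S').subset fun s hs => hs.1).union hS

end Paths

/-! ### Integrability of cadlag functions -/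

section Cadlag

variable {g : ℝ≥0 → ℝ}

/-- A right continuous function is the limit of its right-endpoint discretisations. -/
lemma measurable_of_right_cont (hr : ∀ t, ContinuousWithinAt g (Ici t) t) : Measurable g := by
  refine measurable_of_tendsto_metrizable
    (f := fun (n : ℕ) s => g ((⌊((n : ℝ≥0) + 1) * s⌋₊ + 1 : ℕ) / ((n : ℝ≥0) + 1))) ?_ ?_
  · intro n
    exact (measurable_from_nat (f := fun m : ℕ => g ((m + 1 : ℕ) / ((n : ℝ≥0) + 1)))).comp
      (Nat.measurable_floor.comp (measurable_const.mul measurable_id))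
  · refine tendsto_pi_nhds.2 fun s => (hr s).tendsto.comp (tendsto_nhdsWithin_iff.2 ⟨?_, ?_⟩)
    · have hlim : Tendsto (fun n : ℕ => s + 1 / ((n : ℝ≥0) + 1)) atTop (𝓝 s) := by
        simpa using tendsto_const_nhds.add (tendsto_one_div_add_atTop_nhds_zero_nat (𝕜 := ℝ≥0))
      refine tendsto_of_tendsto_of_tendsto_of_le_of_le tendsto_const_nhds hlim ?_ ?_
      · intro n
        show s ≤ _
        rw [le_div_iff₀ (by positivity), mul_comm]
        exact_mod_cast (Nat.lt_floor_add_one _).le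
      · intro n
        show _ ≤ s + 1 / ((n : ℝ≥0) + 1)
        have e : (s + 1 / ((n : ℝ≥0) + 1)) * ((n : ℝ≥0) + 1) = ((n : ℝ≥0) + 1) * s + 1 := by
          field_simp
        rw [div_le_iff₀ (by positivity), e]
        push_cast
        gcongr
        exact Nat.floor_le (by positivity)
    · refine Eventually.of_forall fun n => ?_
      show s ≤ _
      rw [le_div_iff₀ (by positivity), mul_comm]
      exact_mod_cast (Nat.lt_floor_add_one _).le

lemma exists_bound_of_cadlag (hr : ∀ t, ContinuousWithinAt g (Ici t) t)
    (hl : ∀ t, 0 < t → ∃ l, Tendsto g (𝓝[<] t) (𝓝 l)) (b : ℝ≥0) :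
    ∃ C, ∀ s ∈ Icc 0 b, |g s| ≤ C := by
  refine isCompact_Icc.induction_on (p := fun A => ∃ C, ∀ s ∈ A, |g s| ≤ C) ⟨0, by simp⟩ ?_ ?_ ?_
  · rintro A B hAB ⟨C, hC⟩
    exact ⟨C, fun s hs => hC s (hAB hs)⟩
  · rintro A B ⟨C, hC⟩ ⟨D, hD⟩
    refine ⟨max C D, ?_⟩
    rintro s (hs | hs)
    · exact (hC s hs).trans (le_max_left _ _)
    · exact (hD s hs).trans (le_max_right _ _)
  · intro x _
    have h1 : ∃ C, ∀ᶠ s in 𝓝[≥] x, |g s| ≤ C :=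
      ⟨|g x| + 1, ((hr x).tendsto.abs.eventually_lt_const (lt_add_one _)).mono fun _ h => h.le⟩
    have h2 : ∃ C, ∀ᶠ s in 𝓝[<] x, |g s| ≤ C := by
      rcases eq_or_ne x 0 with rfl | hx
      · refine ⟨0, ?_⟩
        have : Iio (0 : ℝ≥0) = ∅ := by ext; simp
        rw [this, nhdsWithin_empty]
        exact eventually_bot
      · obtain ⟨l, hl⟩ := hl x (pos_iff_ne_zero.2 hx)
        exact ⟨|l| + 1, (hl.abs.eventually_lt_const (lt_add_one _)).mono fun _ h => h.le⟩
    obtain ⟨C, hC⟩ := h1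
    obtain ⟨D, hD⟩ := h2
    refine ⟨{s | |g s| ≤ max C D}, mem_nhdsWithin_of_mem_nhds ?_, max C D, fun s hs => hs⟩
    rw [← nhdsLT_sup_nhdsGE]
    exact ⟨hD.mono fun s hs => hs.trans (le_max_right _ _),
      hC.mono fun s hs => hs.trans (le_max_left _ _)⟩

lemma intervalIntegrable_of_cadlag (hr : ∀ t, ContinuousWithinAt g (Ici t) t)
    (hl : ∀ t, 0 < t → ∃ l, Tendsto g (𝓝[<] t) (𝓝 l)) (a b : ℝ≥0) :
    IntervalIntegrable (fun s : ℝ => g s.toNNReal) volume a b := by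
  have key : ∀ b : ℝ≥0, IntervalIntegrable (fun s : ℝ => g s.toNNReal) volume (0 : ℝ≥0) b := by
    intro b
    obtain ⟨C, hC⟩ := exists_bound_of_cadlag hr hl b
    rw [intervalIntegrable_iff_integrableOn_Ioc_of_le (NNReal.coe_le_coe.2 zero_le)]
    refine Measure.integrableOn_of_bounded (M := C) (by simp)
      ((measurable_of_right_cont hr).comp measurable_real_toNNReal).aestronglyMeasurable ?_
    refine (ae_restrict_iff' measurableSet_Ioc).2 (Eventually.of_forall fun s hs => ?_)
    exact hC _ ⟨zero_le, Real.toNNReal_le_iff_le_coe.2 hs.2⟩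
  exact (key a).symm.trans (key b)

end Cadlag

/-! ### The filtering equation between consecutive jumps of the chain -/

section FilterEquation

variable {I O : Type*}

lemma restr_apply_of_eq {a : O} {i : I} (hi : h i = a) (v : I → ℝ) : restr h a v i = v i :=
  Set.indicator_of_mem (show i ∈ h ⁻¹' {a} from hi) v

lemma restr_apply_of_ne {a : O} {i : I} (hi : h i ≠ a) (v : I → ℝ) : restr h a v i = 0 :=
  Set.indicator_of_notMem (show i ∉ h ⁻¹' {a} from hi) v

variable [Fintype I] {Λ : Matrix I I ℝ} {h : I → O} {ν : O → I → ℝ}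
  {μ : stdSimplex ℝ I} {ω : CadlagPath I} {q : ℝ≥0 → I → ℝ} {S S' : ℝ≥0}

lemma contDiff_restr_vecMul (Λ : Matrix I I ℝ) (h : I → O) (a : O) :
    ContDiff ℝ 1 (fun y : I → ℝ => restr h a (y ᵥ* Λ)) := by
  refine contDiff_pi.2 fun i => ?_
  by_cases hi : h i = a
  · simp only [restr_apply_of_eq hi, Matrix.vecMul, dotProduct]
    fun_prop
  · simp only [restr_apply_of_ne hi]
    fun_prop

lemma contDiff_filterField (Λ : Matrix I I ℝ) (h : I → O) (a : O) :
    ContDiff ℝ 1 (filterField Λ h a) := by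
  have h1 := contDiff_restr_vecMul Λ h a
  have h2 : ContDiff ℝ 1 (fun y : I → ℝ => levelMass h a (y ᵥ* Λ)) :=
    ContDiff.sum fun i _ => contDiff_pi.1 h1 i
  exact h1.sub (h2.smul contDiff_id)

lemma filterField_right_cont (hr : ∀ t, ContinuousWithinAt q (Ici t) t) (ω : CadlagPath I) (i : I)
    (t : ℝ≥0) :
    ContinuousWithinAt (fun s => filterField Λ h (Y h s ω) (q s) i) (Ici t) t := by
  have hev : ∀ᶠ s in 𝓝[≥] t,
      filterField Λ h (Y h t ω) (q s) i = filterField Λ h (Y h s ω) (q s) i :=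
    (ω.2.1 t).mono fun s hs => by rw [Y, Y, X, X, hs]
  refine Tendsto.congr' hev ?_
  exact (((continuous_apply i).comp (contDiff_filterField Λ h (Y h t ω)).continuous).tendsto
    (q t)).comp (hr t).tendsto

lemma filterField_left_lim (hl : ∀ t, 0 < t → ∃ l, Tendsto q (𝓝[<] t) (𝓝 l)) (ω : CadlagPath I)
    (i : I) (t : ℝ≥0) (ht : 0 < t) :
    ∃ l, Tendsto (fun s => filterField Λ h (Y h s ω) (q s) i) (𝓝[<] t) (𝓝 l) := by
  obtain ⟨j, hj⟩ := ω.2.2 t ht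
  obtain ⟨l, hl⟩ := hl t ht
  have hev : ∀ᶠ s in 𝓝[<] t,
      filterField Λ h (h j) (q s) i = filterField Λ h (Y h s ω) (q s) i :=
    hj.mono fun s hs => by rw [Y, X, hs]
  refine ⟨filterField Λ h (h j) l i, Tendsto.congr' hev ?_⟩
  exact (((continuous_apply i).comp (contDiff_filterField Λ h (h j)).continuous).tendsto
    l).comp hl

lemma filterField_intervalIntegrable (hr : ∀ t, ContinuousWithinAt q (Ici t) t)
    (hl : ∀ t, 0 < t → ∃ l, Tendsto q (𝓝[<] t) (𝓝 l)) (ω : CadlagPath I) (i : I) (a b : ℝ≥0) :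
    IntervalIntegrable
      (fun s : ℝ => filterField Λ h (Y h s.toNNReal ω) (q s.toNNReal) i) volume a b :=
  intervalIntegrable_of_cadlag (filterField_right_cont hr ω i) (filterField_left_lim hl ω i) a b

/-- The drift of the filtering equation accumulated over `[S, S']`. -/
noncomputable def drift (Λ : Matrix I I ℝ) (h : I → O) (ω : CadlagPath I) (q : ℝ≥0 → I → ℝ)
    (S S' : ℝ≥0) (i : I) : ℝ :=
  ∫ s in (S : ℝ)..S', filterField Λ h (Y h s.toNNReal ω) (q s.toNNReal) i

/-- The contribution of the jump times up to `t` to the filtering equation. -/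
noncomputable def jumpSum (Λ : Matrix I I ℝ) (h : I → O) (ν : O → I → ℝ) (ω : CadlagPath I)
    (q : ℝ≥0 → I → ℝ) (t : ℝ≥0) (i : I) : ℝ :=
  ∑ᶠ s ∈ jumpTimes h ω ∩ Iic t,
    (opH h ν (Y h s ω) (Function.leftLim q s ᵥ* Λ) i - Function.leftLim q s i)

lemma drift_add (hr : ∀ t, ContinuousWithinAt q (Ici t) t)
    (hl : ∀ t, 0 < t → ∃ l, Tendsto q (𝓝[<] t) (𝓝 l)) (a b c : ℝ≥0) (i : I) :
    drift Λ h ω q a b i + drift Λ h ω q b c i = drift Λ h ω q a c i :=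
  intervalIntegral.integral_add_adjacent_intervals
    (filterField_intervalIntegrable hr hl ω i a b) (filterField_intervalIntegrable hr hl ω i b c)

lemma jumpSum_of_no_jump (hSS : S < S') (hc : ∀ r ∈ Ico S S', X r ω = X S ω)
    (hY : Y h S' ω = Y h S ω) (i : I) : jumpSum Λ h ν ω q S' i = jumpSum Λ h ν ω q S i := by
  rw [jumpSum, jumpTimes_inter_Iic_of_const hSS hc]
  simp [hY, jumpSum]

lemma jumpSum_of_jump (hSS : S < S') (hc : ∀ r ∈ Ico S S', X r ω = X S ω)
    (hY : Y h S' ω ≠ Y h S ω) (i : I) : jumpSum Λ h ν ω q S' i = jumpSum Λ h ν ω q S i +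
      (opH h ν (Y h S' ω) (Function.leftLim q S' ᵥ* Λ) i - Function.leftLim q S' i) := by
  have e : jumpTimes h ω ∩ Iic S' = insert S' (jumpTimes h ω ∩ Iic S) := by
    rw [jumpTimes_inter_Iic_of_const hSS hc]
    ext s
    simp [hY]
  rw [jumpSum, e, finsum_mem_insert _ (fun hm => absurd hm.2 (not_le.2 hSS))
    (finite_jumpTimes_inter_Iic h ω S), add_comm, jumpSum]

lemma jumpSum_zero (i : I) : jumpSum Λ h ν ω q 0 i = 0 := by
  have e : jumpTimes h ω ∩ Iic 0 = ∅ := by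
    refine eq_empty_of_forall_notMem ?_
    rintro s ⟨hj, hs⟩
    exact absurd hj.1 (not_lt.2 hs)
  rw [jumpSum, e]
  simp

/-- If `q` only moves by its drift before `S'`, its left limit at `S'` is given by the drift. -/
lemma leftLim_eq_add_drift (hr : ∀ t, ContinuousWithinAt q (Ici t) t)
    (hl : ∀ t, 0 < t → ∃ l, Tendsto q (𝓝[<] t) (𝓝 l)) (hSS : S < S')
    (hflow : ∀ r ∈ Ico S S', ∀ i, q r i = q S i + drift Λ h ω q S r i) (i : I) :
    Function.leftLim q S' i = q S i + drift Λ h ω q S S' i := by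
  have := nnreal_nhdsLT_neBot (zero_le.trans_lt hSS)
  obtain ⟨l, hql⟩ := hl S' (zero_le.trans_lt hSS)
  rw [leftLim_eq_of_tendsto hql]
  refine tendsto_nhds_unique ((tendsto_pi_nhds.1 hql) i) ?_
  have hS : (S : ℝ) ≤ S' := NNReal.coe_le_coe.2 hSS.le
  have hcont := intervalIntegral.continuousOn_primitive_interval
    (f := fun s : ℝ => filterField Λ h (Y h s.toNNReal ω) (q s.toNNReal) i) (a := S) (b := S')
    (μ := volume) (by
      have := filterField_intervalIntegrable (Λ := Λ) (h := h) hr hl ω i S S'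
      rwa [intervalIntegrable_iff_integrableOn_Icc_of_le hS, ← uIcc_of_le hS] at this)
  have h1 : Tendsto (fun r : ℝ≥0 => drift Λ h ω q S r i) (𝓝[<] S')
      (𝓝 (drift Λ h ω q S S' i)) := by
    refine (hcont S' right_mem_uIcc).tendsto.comp (tendsto_nhdsWithin_iff.2 ⟨?_, ?_⟩)
    · exact (NNReal.continuous_coe.tendsto S').mono_left nhdsWithin_le_nhds
    · filter_upwards [Ico_mem_nhdsLT hSS] with r hr
      rw [uIcc_of_le hS]
      exact ⟨NNReal.coe_le_coe.2 hr.1, NNReal.coe_le_coe.2 hr.2.le⟩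
  refine (h1.const_add (q S i)).congr' ?_
  filter_upwards [Ico_mem_nhdsLT hSS] with r hr
  exact (hflow r hr i).symm

lemma IsFilterSolution.eq_add_drift (hq : IsFilterSolution Λ h ν μ ω q) (hSS : S < S')
    (hc : ∀ r ∈ Ico S S', X r ω = X S ω) (hY : Y h S' ω = Y h S ω) (i : I) :
    q S' i = q S i + drift Λ h ω q S S' i := by
  have h1 : q S' i = _ + drift Λ h ω q 0 S' i + jumpSum Λ h ν ω q S' i := hq.equation S' i
  have h2 : q S i = _ + drift Λ h ω q 0 S i + jumpSum Λ h ν ω q S i := hq.equation S i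
  rw [jumpSum_of_no_jump hSS hc hY, ← drift_add hq.right_cont hq.left_lim 0 S S'] at h1
  linarith

lemma IsFilterSolution.flow (hq : IsFilterSolution Λ h ν μ ω q)
    (hc : ∀ r ∈ Ico S S', X r ω = X S ω) : ∀ r ∈ Ico S S', ∀ i,
      q r i = q S i + drift Λ h ω q S r i := by
  rintro r ⟨h1, h2⟩ i
  rcases h1.eq_or_lt with rfl | h1
  · simp [drift]
  · exact hq.eq_add_drift h1 (fun x hx => hc x ⟨hx.1, hx.2.trans h2⟩)
      (by rw [Y, Y, hc r ⟨h1.le, h2⟩]) i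

lemma IsFilterSolution.eq_leftLim (hq : IsFilterSolution Λ h ν μ ω q) (hSS : S < S')
    (hc : ∀ r ∈ Ico S S', X r ω = X S ω) (hY : Y h S' ω = Y h S ω) :
    q S' = Function.leftLim q S' := by
  ext i
  rw [leftLim_eq_add_drift hq.right_cont hq.left_lim hSS (hq.flow hc), hq.eq_add_drift hSS hc hY]

lemma IsFilterSolution.eq_opH (hq : IsFilterSolution Λ h ν μ ω q) (hSS : S < S')
    (hc : ∀ r ∈ Ico S S', X r ω = X S ω) (hY : Y h S' ω ≠ Y h S ω) :
    q S' = opH h ν (Y h S' ω) (Function.leftLim q S' ᵥ* Λ) := by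
  ext i
  have h0 := leftLim_eq_add_drift hq.right_cont hq.left_lim hSS (hq.flow hc) i
  have h1 : q S' i = _ + drift Λ h ω q 0 S' i + jumpSum Λ h ν ω q S' i := hq.equation S' i
  have h2 : q S i = _ + drift Λ h ω q 0 S i + jumpSum Λ h ν ω q S i := hq.equation S i
  rw [jumpSum_of_jump hSS hc hY, ← drift_add hq.right_cont hq.left_lim 0 S S'] at h1
  linarith

lemma IsFilterSolution.apply_zero (hq : IsFilterSolution Λ h ν μ ω q) :
    q 0 = opH h ν (Y h 0 ω) μ.1 := by
  ext i
  have h1 : q 0 i = _ + drift Λ h ω q 0 0 i + jumpSum Λ h ν ω q 0 i := hq.equation 0 i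
  rw [h1, jumpSum_zero]
  simp [drift]

/-- The filtering equation may be checked on the intervals of constancy of the path. -/
lemma isFilterSolution_of_steps (hr : ∀ t, ContinuousWithinAt q (Ici t) t)
    (hl : ∀ t, 0 < t → ∃ l, Tendsto q (𝓝[<] t) (𝓝 l)) (h0 : q 0 = opH h ν (Y h 0 ω) μ.1)
    (hflow : ∀ S S', S < S' → (∀ r ∈ Ico S S', X r ω = X S ω) → ∀ i,
      Function.leftLim q S' i = q S i + drift Λ h ω q S S' i)
    (hno : ∀ S S', S < S' → (∀ r ∈ Ico S S', X r ω = X S ω) → Y h S' ω = Y h S ω →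
      q S' = Function.leftLim q S')
    (hjump : ∀ S S', S < S' → (∀ r ∈ Ico S S', X r ω = X S ω) → Y h S' ω ≠ Y h S ω →
      q S' = opH h ν (Y h S' ω) (Function.leftLim q S' ᵥ* Λ)) :
    IsFilterSolution Λ h ν μ ω q := by
  refine ⟨hr, hl, fun t => ?_⟩
  show ∀ i, q t i = _ + drift Λ h ω q 0 t i + jumpSum Λ h ν ω q t i
  refine ω.path_induction (G := fun t => ∀ i, q t i = opH h ν (Y h 0 ω) μ.1 i +
    drift Λ h ω q 0 t i + jumpSum Λ h ν ω q t i) (fun i => ?_) ?_ t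
  · rw [jumpSum_zero, h0]
    simp [drift]
  · intro S S' hSS hc ih i
    have hf := hflow S S' hSS hc i
    by_cases hY : Y h S' ω = Y h S ω
    · rw [jumpSum_of_no_jump hSS hc hY, ← drift_add hr hl 0 S S', hno S S' hSS hc hY, hf, ih i]
      ring
    · rw [jumpSum_of_jump hSS hc hY, ← drift_add hr hl 0 S S', ← hjump S S' hSS hc hY, hf, ih i]
      ring

/-! ### Uniqueness of the solution -/

/-- On an interval where the path is constant, the integral form of the equation is the
autonomous differential equation of the vector field `filterField`. -/
lemma continuousOn_and_hasDeriv_of_flow (hr : ∀ t, ContinuousWithinAt q (Ici t) t)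
    (hl : ∀ t, 0 < t → ∃ l, Tendsto q (𝓝[<] t) (𝓝 l)) {a : O} {r : ℝ≥0} (hSr : S ≤ r)
    (ha : ∀ s ∈ Icc S r, Y h s ω = a)
    (hflow : ∀ s ∈ Icc S r, ∀ i, q s i = q S i + drift Λ h ω q S s i) :
    ContinuousOn (fun x : ℝ => q x.toNNReal) (Icc S r) ∧
    ∀ x ∈ Ico (S : ℝ) r, HasDerivWithinAt (fun x : ℝ => q x.toNNReal)
      (filterField Λ h a (q x.toNNReal)) (Ici x) x := by
  have hS : (S : ℝ) ≤ r := NNReal.coe_le_coe.2 hSr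
  have hmem : ∀ x ∈ Icc (S : ℝ) r, x.toNNReal ∈ Icc S r := fun x hx =>
    ⟨NNReal.le_toNNReal_of_coe_le hx.1, Real.toNNReal_le_iff_le_coe.2 hx.2⟩
  have hx0 : ∀ x ∈ Icc (S : ℝ) r, 0 ≤ x := fun x hx => S.2.trans hx.1
  have heq : ∀ i, ∀ x ∈ Icc (S : ℝ) r, q x.toNNReal i = q S i +
      ∫ s in (S : ℝ)..x, filterField Λ h (Y h s.toNNReal ω) (q s.toNNReal) i := by
    intro i x hx
    rw [hflow _ (hmem x hx) i, drift, Real.coe_toNNReal x (hx0 x hx)]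
  constructor
  · refine continuousOn_pi.2 fun i => ?_
    have hcont := intervalIntegral.continuousOn_primitive_interval
      (f := fun s : ℝ => filterField Λ h (Y h s.toNNReal ω) (q s.toNNReal) i) (a := S) (b := r)
      (μ := volume) (by
        have := filterField_intervalIntegrable (Λ := Λ) (h := h) hr hl ω i S r
        rwa [intervalIntegrable_iff_integrableOn_Icc_of_le hS, ← uIcc_of_le hS] at this)
    rw [uIcc_of_le hS] at hcont
    exact (hcont.const_add (q S i)).congr (heq i)
  · intro x hx
    have hxI : x ∈ Icc (S : ℝ) r := Ico_subset_Icc_self hx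
    refine hasDerivWithinAt_pi.2 fun i => ?_
    have hint := filterField_intervalIntegrable (Λ := Λ) (h := h) hr hl ω i S x.toNNReal
    rw [Real.coe_toNNReal x (hx0 x hxI)] at hint
    have hmeas : Measurable
        (fun s : ℝ => filterField Λ h (Y h s.toNNReal ω) (q s.toNNReal) i) :=
      (measurable_of_right_cont (filterField_right_cont hr ω i)).comp measurable_real_toNNReal
    have hcw : ContinuousWithinAt
        (fun s : ℝ => filterField Λ h (Y h s.toNNReal ω) (q s.toNNReal) i) (Ioi x) x := by
      refine ContinuousWithinAt.comp (t := Ici x.toNNReal)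
        (g := fun s => filterField Λ h (Y h s ω) (q s) i) (filterField_right_cont hr ω i _)
        (continuous_real_toNNReal.continuousWithinAt) ?_
      exact fun y hy => Real.toNNReal_le_toNNReal (le_of_lt hy)
    have hd := (intervalIntegral.integral_hasDerivWithinAt_right hint (s := Ici x) (t := Ioi x)
      hmeas.stronglyMeasurable.stronglyMeasurableAtFilter hcw).const_add (q S i)
    rw [ha _ (hmem x hxI)] at hd
    refine hd.congr_of_eventuallyEq ?_ (heq i x hxI)
    filter_upwards [Ico_mem_nhdsGE hx.2] with y hy
    exact heq i y ⟨hxI.1.trans hy.1, hy.2.le⟩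

/-- Uniqueness: two solutions agree until the next jump because the vector field is Lipschitz on
bounded sets, hence so do their left limits, which determine the value after the jump. -/
lemma IsFilterSolution.eq {p : ℝ≥0 → I → ℝ} (hp : IsFilterSolution Λ h ν μ ω p)
    (hq : IsFilterSolution Λ h ν μ ω q) : p = q := by
  funext t
  refine ω.path_induction (G := fun t => p t = q t) ?_ ?_ t
  · rw [hp.apply_zero, hq.apply_zero]
  intro S S' hSS hc ih
  have hIco : ∀ r ∈ Ico S S', p r = q r := by
    rintro r ⟨hSr, hrS⟩
    have ha : ∀ s ∈ Icc S r, Y h s ω = Y h S ω := fun s hs => by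
      rw [Y, Y, hc s ⟨hs.1, hs.2.trans_lt hrS⟩]
    obtain ⟨pc, pd⟩ := continuousOn_and_hasDeriv_of_flow hp.right_cont hp.left_lim hSr ha
      fun s hs => hp.flow hc s ⟨hs.1, hs.2.trans_lt hrS⟩
    obtain ⟨qc, qd⟩ := continuousOn_and_hasDeriv_of_flow hq.right_cont hq.left_lim hSr ha
      fun s hs => hq.flow hc s ⟨hs.1, hs.2.trans_lt hrS⟩
    obtain ⟨R, hR⟩ := ((isCompact_Icc.image_of_continuousOn pc).union
      (isCompact_Icc.image_of_continuousOn qc)).isBounded.subset_closedBall 0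
    obtain ⟨K, hK⟩ := (contDiff_filterField Λ h (Y h S ω)).contDiffOn.exists_lipschitzOnWith
      one_ne_zero (convex_closedBall (0 : I → ℝ) R) (isCompact_closedBall _ _)
    have := ODE_solution_unique_of_mem_Icc_right (v := fun _ => filterField Λ h (Y h S ω))
      (s := fun _ => Metric.closedBall 0 R) (fun _ _ => hK) pc pd
      (fun x hx => hR (Or.inl (mem_image_of_mem _ (Ico_subset_Icc_self hx)))) qc qd
      (fun x hx => hR (Or.inr (mem_image_of_mem _ (Ico_subset_Icc_self hx))))
      (by simpa using ih)
    simpa using this (right_mem_Icc.2 (NNReal.coe_le_coe.2 hSr))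
  have hleft : Function.leftLim p S' = Function.leftLim q S' := by
    have := nnreal_nhdsLT_neBot (zero_le.trans_lt hSS)
    obtain ⟨l, hl⟩ := hp.left_lim S' (zero_le.trans_lt hSS)
    rw [leftLim_eq_of_tendsto hl, leftLim_eq_of_tendsto (hl.congr' ?_)]
    filter_upwards [Ico_mem_nhdsLT hSS] with r hr using hIco r hr
  by_cases hY : Y h S' ω = Y h S ω
  · rw [hp.eq_leftLim hSS hc hY, hq.eq_leftLim hSS hc hY, hleft]
  · rw [hp.eq_opH hSS hc hY, hq.eq_opH hSS hc hY, hleft]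

lemma IsFilterSolution.filteringProcess_eq {p : ℝ≥0 → I → ℝ}
    (hp : IsFilterSolution Λ h ν μ ω p) (t : ℝ≥0) : filteringProcess Λ h ν μ t ω = p t := by
  have : IsFilterSolution Λ h ν μ ω
      (Classical.epsilon fun p : ℝ≥0 → I → ℝ => IsFilterSolution Λ h ν μ ω p) :=
    Classical.epsilon_spec (p := fun p => IsFilterSolution Λ h ν μ ω p) ⟨p, hp⟩
  rw [filteringProcess, this.eq hp]

end FilterEquation

/-! ### The filter of the chain observed on a grid -/

section GridFilter

variable {I O : Type*}

open Classical in
/-- The block of `A` with row and column indices in the level set `h⁻¹(a)`, extended by `0`. -/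
noncomputable def levelBlock (h : I → O) (a : O) (A : Matrix I I ℝ) : Matrix I I ℝ :=
  fun i j => if h i = a ∧ h j = a then A i j else 0

lemma restr_smul (h : I → O) (a : O) (c : ℝ) (v : I → ℝ) :
    restr h a (c • v) = c • restr h a v := by
  ext i
  by_cases hi : h i = a
  · simp [restr_apply_of_eq hi]
  · simp [restr_apply_of_ne hi]

lemma tendsto_restr {ι : Type*} {l : Filter ι} {f : ι → I → ℝ} {v : I → ℝ}
    (h : I → O) (a : O) (hf : Tendsto f l (𝓝 v)) :
    Tendsto (fun n => restr h a (f n)) l (𝓝 (restr h a v)) := by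
  refine tendsto_pi_nhds.2 fun i => ?_
  by_cases hi : h i = a
  · simpa only [restr_apply_of_eq hi] using tendsto_pi_nhds.1 hf i
  · simpa only [restr_apply_of_ne hi] using tendsto_const_nhds

lemma tendsto_levelBlock {ι : Type*} {l : Filter ι} {A : ι → Matrix I I ℝ} {B : Matrix I I ℝ}
    (h : I → O) (a : O) (hA : Tendsto A l (𝓝 B)) :
    Tendsto (fun n => levelBlock h a (A n)) l (𝓝 (levelBlock h a B)) := by
  refine tendsto_pi_nhds.2 fun i => tendsto_pi_nhds.2 fun j => ?_
  simp only [levelBlock]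
  split_ifs
  · exact tendsto_pi_nhds.1 (tendsto_pi_nhds.1 hA i) j
  · exact tendsto_const_nhds

variable [Fintype I]

/-- The vector `u` divided by its total mass; it is `0` when the mass vanishes. -/
noncomputable def normMass (u : I → ℝ) : I → ℝ := (∑ i, u i)⁻¹ • u

/-- The unnormalised filter at step `k` of a Markov chain with one-step transition matrix `E` and
initial vector `v`, given the sequence of observations `a`. -/
noncomputable def obsVec (E : Matrix I I ℝ) (h : I → O) (v : I → ℝ) (a : ℕ → O) : ℕ → I → ℝ
  | 0 => restr h (a 0) v
  | k + 1 => restr h (a (k + 1)) (obsVec E h v a k ᵥ* E)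

lemma normMass_smul {c : ℝ} (hc : c ≠ 0) (u : I → ℝ) : normMass (c • u) = normMass u := by
  ext i
  simp only [normMass, Pi.smul_apply, smul_eq_mul, ← Finset.mul_sum, mul_inv]
  field_simp

lemma normMass_of_sum_eq_one {u : I → ℝ} (hu : ∑ i, u i = 1) : normMass u = u := by
  simp [normMass, hu]

lemma sum_normMass {u : I → ℝ} (hu : ∑ i, u i ≠ 0) : ∑ i, normMass u i = 1 := by
  simp only [normMass, Pi.smul_apply, smul_eq_mul, ← Finset.mul_sum]
  exact inv_mul_cancel₀ hu

lemma tendsto_normMass {ι : Type*} {l : Filter ι} {f : ι → I → ℝ} {v : I → ℝ}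
    (hf : Tendsto f l (𝓝 v)) (hv : ∑ i, v i ≠ 0) :
    Tendsto (fun n => normMass (f n)) l (𝓝 (normMass v)) := by
  have : Tendsto (fun n => ∑ i, f n i) l (𝓝 (∑ i, v i)) :=
    tendsto_finsetSum _ fun i _ => tendsto_pi_nhds.1 hf i
  exact (this.inv₀ hv).smul hf

lemma normMass_vecMul {u : I → ℝ} (hu : ∑ i, u i ≠ 0) (A : Matrix I I ℝ) :
    normMass (normMass u ᵥ* A) = normMass (u ᵥ* A) := by
  conv_lhs => rw [normMass.eq_1 u, Matrix.smul_vecMul]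
  exact normMass_smul (inv_ne_zero hu) _

lemma opH_eq_normMass {h : I → O} {ν : O → I → ℝ} {a : O} {v : I → ℝ}
    (hv : ∑ i, restr h a v i ≠ 0) : opH h ν a v = normMass (restr h a v) :=
  if_neg hv

lemma obsVec_eq_zero (E : Matrix I I ℝ) {h : I → O} (v : I → ℝ) (a : ℕ → O) (k : ℕ) {j : I}
    (hj : h j ≠ a k) : obsVec E h v a k j = 0 := by
  cases k <;> exact restr_apply_of_ne hj _

lemma obsVec_congr (E : Matrix I I ℝ) (h : I → O) (v : I → ℝ) {a a' : ℕ → O} {k : ℕ}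
    (ha : ∀ l ≤ k, a l = a' l) : obsVec E h v a k = obsVec E h v a' k := by
  induction k with
  | zero => rw [obsVec, obsVec, ha 0 le_rfl]
  | succ k ih =>
    rw [obsVec, obsVec, ha (k + 1) le_rfl, ih fun l hl => ha l (hl.trans (Nat.le_succ k))]

lemma vecMul_levelBlock {h : I → O} {a : O} {v : I → ℝ} (hv : ∀ j, h j ≠ a → v j = 0)
    (A : Matrix I I ℝ) : v ᵥ* levelBlock h a A = restr h a (v ᵥ* A) := by
  ext j
  by_cases hj : h j = a
  · rw [restr_apply_of_eq hj]
    refine Finset.sum_congr rfl fun i _ => ?_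
    by_cases hi : h i = a
    · simp [levelBlock, hi, hj]
    · simp [hv i hi]
  · rw [restr_apply_of_ne hj]
    exact Finset.sum_eq_zero fun i _ => by simp [levelBlock, hj]

lemma levelBlock_off_diag_nonneg {Λ : Matrix I I ℝ} {h : I → O} (hΛ : IsRateMatrix Λ) (a : O)
    (i j : I) (hij : i ≠ j) : 0 ≤ levelBlock h a Λ i j := by
  rw [levelBlock]
  split_ifs
  exacts [hΛ.off_diag_nonneg i j hij, le_rfl]

lemma tendsto_vecMul {ι : Type*} {l : Filter ι} {f : ι → I → ℝ} {A : ι → Matrix I I ℝ}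
    {v : I → ℝ} {B : Matrix I I ℝ} (hf : Tendsto f l (𝓝 v)) (hA : Tendsto A l (𝓝 B)) :
    Tendsto (fun n => f n ᵥ* A n) l (𝓝 (v ᵥ* B)) := by
  have : Continuous fun p : (I → ℝ) × Matrix I I ℝ => p.1 ᵥ* p.2 :=
    continuous_fst.matrix_vecMul continuous_snd
  exact (this.tendsto (v, B)).comp (hf.prodMk_nhds hA)

lemma sum_ne_zero_of_sum_normMass {u : I → ℝ} (hu : ∑ i, normMass u i ≠ 0) : ∑ i, u i ≠ 0 := by
  intro h0
  exact hu (by simp [normMass, h0])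

variable [DecidableEq I]

lemma vecMul_one_add_levelBlock {h : I → O} {a : O} {v : I → ℝ} (hv : ∀ j, h j ≠ a → v j = 0)
    (E : Matrix I I ℝ) : v ᵥ* (1 + levelBlock h a (E - 1)) = restr h a (v ᵥ* E) := by
  rw [Matrix.vecMul_add, Matrix.vecMul_one, vecMul_levelBlock hv, Matrix.vecMul_sub,
    Matrix.vecMul_one]
  ext j
  by_cases hj : h j = a
  · simp [restr_apply_of_eq hj]
  · simp [restr_apply_of_ne hj, hv j hj]

/-- During a run of constant observations the unnormalised filter is multiplied by powers of one
matrix, a perturbation of the identity even off the observed level set. -/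
lemma obsVec_add (E : Matrix I I ℝ) (h : I → O) (v : I → ℝ) {a : ℕ → O} {b : O} {k m : ℕ}
    (ha : ∀ l, k ≤ l → l ≤ k + m → a l = b) :
    obsVec E h v a (k + m) = obsVec E h v a k ᵥ* (1 + levelBlock h b (E - 1)) ^ m := by
  induction m with
  | zero => simp
  | succ m ih =>
    have hm := ih fun l h1 h2 => ha l h1 (h2.trans (Nat.le_succ _))
    rw [pow_succ, ← Matrix.vecMul_vecMul, ← hm, vecMul_one_add_levelBlock, ← add_assoc, obsVec,
      ha (k + m + 1) (by omega) (by omega)]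
    intro j hj
    exact obsVec_eq_zero E v a (k + m) (by rwa [ha (k + m) (by omega) (by omega)])

/-- The filter at time `k δ` for the observations `Y_0, Y_δ, …, Y_{kδ}` of the path `ω`. -/
noncomputable def gridFilter (Λ : Matrix I I ℝ) (h : I → O) (v : I → ℝ) (ω : CadlagPath I)
    (δ : ℝ≥0) (k : ℕ) : I → ℝ :=
  normMass (obsVec (NormedSpace.exp ((δ : ℝ) • Λ)) h v (fun l => Y h (l * δ) ω) k)

end GridFilter

/-! ### Fine grids -/

section Grid

lemma tendsto_ceil_mul (s : ℝ≥0) :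
    Tendsto (fun δ : ℝ≥0 => (⌈s / δ⌉₊ : ℝ≥0) * δ) (𝓝[>] 0) (𝓝[≥] s) := by
  have hle : ∀ᶠ δ : ℝ≥0 in 𝓝[>] 0, s ≤ (⌈s / δ⌉₊ : ℝ≥0) * δ := by
    filter_upwards [self_mem_nhdsWithin] with δ hδ
    rw [← div_le_iff₀ hδ]
    exact Nat.le_ceil _
  refine tendsto_nhdsWithin_iff.2 ⟨?_, hle⟩
  have hlim : Tendsto (fun δ : ℝ≥0 => s + δ) (𝓝[>] 0) (𝓝 s) := by
    simpa using (tendsto_const_nhds (x := s)).add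
      (tendsto_id.mono_left (nhdsWithin_le_nhds (a := (0 : ℝ≥0)) (s := Ioi 0)))
  refine tendsto_of_tendsto_of_tendsto_of_le_of_le' tendsto_const_nhds hlim hle ?_
  filter_upwards [self_mem_nhdsWithin] with δ hδ
  calc (⌈s / δ⌉₊ : ℝ≥0) * δ ≤ (s / δ + 1) * δ := by
        gcongr
        exact (Nat.ceil_lt_add_one zero_le).le
    _ = s + δ := by rw [add_mul, one_mul, div_mul_cancel₀ _ (ne_of_gt hδ)]

lemma eventually_ceil_lt_ceil {S S' : ℝ≥0} (hSS : S < S') :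
    ∀ᶠ δ : ℝ≥0 in 𝓝[>] 0, ⌈S / δ⌉₊ < ⌈S' / δ⌉₊ := by
  have h := (tendsto_ceil_mul S).mono_right nhdsWithin_le_nhds
  filter_upwards [h.eventually_lt_const hSS, self_mem_nhdsWithin] with δ h1 hδ
  rwa [Nat.lt_ceil, lt_div_iff₀ hδ]

lemma mem_Ico_of_ceil_le {S S' δ : ℝ≥0} (hδ : 0 < δ) {l : ℕ} (h1 : ⌈S / δ⌉₊ ≤ l)
    (h2 : l < ⌈S' / δ⌉₊) : (l : ℝ≥0) * δ ∈ Ico S S' :=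
  ⟨(div_le_iff₀ hδ).1 (Nat.ceil_le.1 h1), (lt_div_iff₀ hδ).1 (Nat.lt_ceil.1 h2)⟩

lemma eventually_Y_ceil {I O : Type*} (h : I → O) (ω : CadlagPath I) (s : ℝ≥0) :
    ∀ᶠ δ : ℝ≥0 in 𝓝[>] 0, Y h (⌈s / δ⌉₊ * δ) ω = Y h s ω :=
  ((tendsto_ceil_mul s).eventually (ω.2.1 s)).mono fun δ hδ => by rw [Y, Y, X, X, hδ]

lemma tendsto_coe_nhdsGT_zero : Tendsto (fun δ : ℝ≥0 => (δ : ℝ)) (𝓝[>] 0) (𝓝 0) :=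
  (NNReal.continuous_coe.tendsto 0).mono_left nhdsWithin_le_nhds

lemma tendsto_ceil_sub_mul {S S' : ℝ≥0} (hSS : S < S') :
    Tendsto (fun δ : ℝ≥0 => ((⌈S' / δ⌉₊ - ⌈S / δ⌉₊ : ℕ) : ℝ) * δ) (𝓝[>] 0)
      (𝓝 ((S' : ℝ) - S)) := by
  have h : ∀ s : ℝ≥0, Tendsto (fun δ : ℝ≥0 => (⌈s / δ⌉₊ : ℝ) * δ) (𝓝[>] 0) (𝓝 (s : ℝ)) := by
    intro s
    have := (NNReal.continuous_coe.tendsto s).comp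
      ((tendsto_ceil_mul s).mono_right nhdsWithin_le_nhds)
    exact this.congr fun δ => by simp
  refine ((h S').sub (h S)).congr' ?_
  filter_upwards [eventually_ceil_lt_ceil hSS] with δ hδ
  rw [Nat.cast_sub hδ.le, sub_mul]

lemma tendsto_ceil_sub_sub_one_mul {S S' : ℝ≥0} (hSS : S < S') :
    Tendsto (fun δ : ℝ≥0 => ((⌈S' / δ⌉₊ - ⌈S / δ⌉₊ - 1 : ℕ) : ℝ) * δ) (𝓝[>] 0)
      (𝓝 ((S' : ℝ) - S)) := by
  have := (tendsto_ceil_sub_mul hSS).sub tendsto_coe_nhdsGT_zero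
  rw [sub_zero] at this
  refine this.congr' ?_
  filter_upwards [eventually_ceil_lt_ceil hSS] with δ hδ
  rw [Nat.cast_sub (Nat.sub_pos_of_lt hδ), Nat.cast_one, sub_mul, one_mul]

end Grid

/-! ### Convergence of the grid filters along a path -/

section Limit

variable {I O : Type*} [Fintype I] [DecidableEq I] {Λ : Matrix I I ℝ} {h : I → O}

/-- The unnormalised filter after a time `τ` during which the observation stays equal to `a`. -/
noncomputable def levelFlow (Λ : Matrix I I ℝ) (h : I → O) (a : O) (v : I → ℝ) (τ : ℝ) : I → ℝ :=
  v ᵥ* NormedSpace.exp (τ • levelBlock h a Λ)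

lemma hasDerivAt_levelFlow (Λ : Matrix I I ℝ) (h : I → O) (a : O) (v : I → ℝ) (τ : ℝ) :
    HasDerivAt (levelFlow Λ h a v) (levelFlow Λ h a v τ ᵥ* levelBlock h a Λ) τ := by
  refine hasDerivAt_pi.2 fun j => ?_
  have hE := matrix_hasDerivAt_exp (levelBlock h a Λ) τ
  have hE' : ∀ i, HasDerivAt (fun s : ℝ => NormedSpace.exp (s • levelBlock h a Λ) i j)
      ((NormedSpace.exp (τ • levelBlock h a Λ) * levelBlock h a Λ) i j) τ := fun i =>
    hasDerivAt_pi.1 (hasDerivAt_pi.1 hE i) j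
  rw [levelFlow, Matrix.vecMul_vecMul]
  exact HasDerivAt.fun_sum fun i _ => (hE' i).const_mul (v i)

lemma levelFlow_eq_zero {a : O} {v : I → ℝ} (hv : ∀ j, h j ≠ a → v j = 0) (τ : ℝ) {j : I}
    (hj : h j ≠ a) : levelFlow Λ h a v τ j = 0 := by
  have hd : ∀ s, HasDerivAt (fun s => levelFlow Λ h a v s j) 0 s := by
    intro s
    have := hasDerivAt_pi.1 (hasDerivAt_levelFlow Λ h a v s) j
    have e : (levelFlow Λ h a v s ᵥ* levelBlock h a Λ) j = 0 :=
      Finset.sum_eq_zero fun i _ => by simp [levelBlock, hj]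
    rwa [e] at this
  have := is_const_of_deriv_eq_zero (fun s => (hd s).differentiableAt) (fun s => (hd s).deriv) τ 0
  rw [this]
  simp [levelFlow, NormedSpace.exp_zero, hv j hj]

lemma levelFlow_nonneg (hΛ : IsRateMatrix Λ) (a : O) {v : I → ℝ} (hv : ∀ j, 0 ≤ v j) {τ : ℝ}
    (hτ : 0 ≤ τ) (j : I) : 0 ≤ levelFlow Λ h a v τ j :=
  Finset.sum_nonneg fun i _ => mul_nonneg (hv i)
    (exp_smul_apply_nonneg (levelBlock_off_diag_nonneg hΛ a) hτ i j)

lemma levelFlow_pos (hΛ : IsRateMatrix Λ) {v : I → ℝ} (hv : ∀ j, 0 ≤ v j) {τ : ℝ}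
    (hτ : 0 < τ) {i j : I} (hi : 0 < v i) (hij : j = i ∨ (h j = h i ∧ 0 < Λ i j)) :
    0 < levelFlow Λ h (h i) v τ j := by
  have hB := levelBlock_off_diag_nonneg (h := h) hΛ (h i)
  refine Finset.sum_pos' (fun k _ => mul_nonneg (hv k) (exp_smul_apply_nonneg hB hτ.le k j))
    ⟨i, Finset.mem_univ i, mul_pos hi (exp_smul_apply_pos hB hτ ?_)⟩
  rcases hij with rfl | ⟨h1, h2⟩
  · exact Or.inl rfl
  · exact Or.inr (by simpa [levelBlock, h1] using h2)

/-- The normalised flow solves the filtering equation without jumps. -/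
lemma hasDerivAt_normMass_levelFlow {a : O} {v : I → ℝ} (hv : ∀ j, h j ≠ a → v j = 0) {τ : ℝ}
    (hm : ∑ i, levelFlow Λ h a v τ i ≠ 0) :
    HasDerivAt (fun s => normMass (levelFlow Λ h a v s))
      (filterField Λ h a (normMass (levelFlow Λ h a v τ))) τ := by
  have hd := hasDerivAt_levelFlow Λ h a v τ
  have hsum : HasDerivAt (fun s => ∑ i, levelFlow Λ h a v s i)
      (∑ i, (levelFlow Λ h a v τ ᵥ* levelBlock h a Λ) i) τ :=
    HasDerivAt.fun_sum fun i _ => hasDerivAt_pi.1 hd i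
  have := (hsum.fun_inv hm).fun_smul hd
  rw [vecMul_levelBlock fun j hj => levelFlow_eq_zero hv τ hj] at this
  convert! this using 1
  ext i
  simp only [filterField, normMass, Matrix.smul_vecMul, levelMass, restr_smul, Pi.sub_apply,
    Pi.smul_apply, Pi.add_apply, smul_eq_mul, ← Finset.mul_sum]
  field_simp
  ring

lemma tendsto_vecMul_pow_levelFlow {f : ℝ≥0 → I → ℝ} {v : I → ℝ} [Nonempty I]
    (hf : Tendsto f (𝓝[>] 0) (𝓝 v)) (a : O) {m : ℝ≥0 → ℕ} {τ : ℝ}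
    (hm : Tendsto (fun δ : ℝ≥0 => (m δ : ℝ) * δ) (𝓝[>] 0) (𝓝 τ)) :
    Tendsto (fun δ : ℝ≥0 =>
      f δ ᵥ* (1 + levelBlock h a (NormedSpace.exp ((δ : ℝ) • Λ) - 1)) ^ m δ) (𝓝[>] 0)
      (𝓝 (levelFlow Λ h a v τ)) := by
  refine tendsto_vecMul hf (matrix_tendsto_pow_exp (δ := fun δ : ℝ≥0 => (δ : ℝ)) ?_
    tendsto_coe_nhdsGT_zero ?_ hm)
  · filter_upwards [self_mem_nhdsWithin] with δ hδ using hδ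
  · refine (tendsto_levelBlock h a (matrix_tendsto_exp_sub_one Λ)).congr fun δ => ?_
    ext i j
    simp [levelBlock]

variable {μ : I → ℝ} {ω : CadlagPath I} {S S' : ℝ≥0} {v : I → ℝ}

/-- The grid filters at time `s` converge to `v` as the mesh of the grid goes to `0`. -/
def GridLimit (Λ : Matrix I I ℝ) (h : I → O) (μ : I → ℝ) (ω : CadlagPath I) (s : ℝ≥0)
    (v : I → ℝ) : Prop :=
  Tendsto (fun δ : ℝ≥0 => gridFilter Λ h μ ω δ ⌈s / δ⌉₊) (𝓝[>] 0) (𝓝 v)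

lemma GridLimit.eventually_sum_ne_zero (hS : GridLimit Λ h μ ω S v) (hv : ∑ i, v i = 1) :
    ∀ᶠ δ : ℝ≥0 in 𝓝[>] 0, ∑ i, obsVec (NormedSpace.exp ((δ : ℝ) • Λ)) h μ
      (fun l => Y h (l * δ) ω) ⌈S / δ⌉₊ i ≠ 0 := by
  have h1 : Tendsto (fun δ : ℝ≥0 => ∑ i, gridFilter Λ h μ ω δ ⌈S / δ⌉₊ i) (𝓝[>] 0)
      (𝓝 (∑ i, v i)) := tendsto_finsetSum _ fun i _ => tendsto_pi_nhds.1 hS i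
  rw [hv] at h1
  exact (h1.eventually_ne one_ne_zero).mono fun δ hδ => sum_ne_zero_of_sum_normMass hδ

lemma GridLimit.step_no_jump [Nonempty I] (hS : GridLimit Λ h μ ω S v) (hv : ∑ i, v i = 1)
    (hSS : S < S') (hc : ∀ r ∈ Ico S S', X r ω = X S ω) (hY : Y h S' ω = Y h S ω)
    (hm : ∑ i, levelFlow Λ h (Y h S ω) v (S' - S) i ≠ 0) :
    GridLimit Λ h μ ω S' (normMass (levelFlow Λ h (Y h S ω) v (S' - S))) := by
  refine (tendsto_normMass (tendsto_vecMul_pow_levelFlow hS (Y h S ω)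
    (tendsto_ceil_sub_mul hSS)) hm).congr' ?_
  filter_upwards [hS.eventually_sum_ne_zero hv, eventually_ceil_lt_ceil hSS,
    eventually_Y_ceil h ω S', self_mem_nhdsWithin] with δ hsum hlt hYc hδ
  rw [gridFilter, gridFilter, normMass_vecMul hsum, ← obsVec_add, Nat.add_sub_cancel' hlt.le]
  intro l h1 h2
  rw [Nat.add_sub_cancel' hlt.le] at h2
  rcases h2.eq_or_lt with rfl | h2
  · rw [hYc, hY]
  · rw [Y, Y, hc _ (mem_Ico_of_ceil_le hδ h1 h2)]

lemma GridLimit.step_jump [Nonempty I] (hS : GridLimit Λ h μ ω S v) (hv : ∑ i, v i = 1)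
    (hSS : S < S') (hc : ∀ r ∈ Ico S S', X r ω = X S ω) (hY : Y h S' ω ≠ Y h S ω)
    (hm : ∑ i, restr h (Y h S' ω) (levelFlow Λ h (Y h S ω) v (S' - S) ᵥ* Λ) i ≠ 0) :
    GridLimit Λ h μ ω S'
      (normMass (restr h (Y h S' ω) (levelFlow Λ h (Y h S ω) v (S' - S) ᵥ* Λ))) := by
  refine (tendsto_normMass (tendsto_restr h (Y h S' ω) (tendsto_vecMul
    (tendsto_vecMul_pow_levelFlow hS (Y h S ω) (tendsto_ceil_sub_sub_one_mul hSS))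
    (matrix_tendsto_exp_sub_one Λ))) hm).congr' ?_
  filter_upwards [hS.eventually_sum_ne_zero hv, eventually_ceil_lt_ceil hSS,
    eventually_Y_ceil h ω S', self_mem_nhdsWithin] with δ hsum hlt hYc hδ
  have hδ' : (δ : ℝ)⁻¹ ≠ 0 := inv_ne_zero (NNReal.coe_ne_zero.2 (ne_of_gt hδ))
  set E := NormedSpace.exp ((δ : ℝ) • Λ)
  set u := obsVec E h μ (fun l => Y h (l * δ) ω)
  set k := ⌈S / δ⌉₊
  obtain ⟨m, hm⟩ : ∃ m, ⌈S' / δ⌉₊ = k + m + 1 := ⟨⌈S' / δ⌉₊ - k - 1, by omega⟩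
  have hlev : ∀ l, k ≤ l → l ≤ k + m → Y h (l * δ) ω = Y h S ω := by
    intro l h1 h2
    rw [Y, Y, hc _ (mem_Ico_of_ceil_le hδ h1 (by omega))]
  have e1 : ⌈S' / δ⌉₊ - k - 1 = m := by omega
  -- The filter before the jump vanishes on the new level set, so `E` may be replaced by `E - 1`,
  -- which is of order `δ`.
  have e2 : u ⌈S' / δ⌉₊ = restr h (Y h S' ω) (u (k + m) ᵥ* (E - 1)) := by
    rw [← hYc, hm]
    ext j
    show restr h _ (u (k + m) ᵥ* E) j = _
    by_cases hj : h j = Y h ((k + m + 1 : ℕ) * δ) ω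
    · have : u (k + m) j = 0 := by
        refine obsVec_eq_zero E μ _ (k + m) ?_
        show h j ≠ Y h ((k + m : ℕ) * δ) ω
        rw [hj, ← hm, hYc, hlev (k + m) (by omega) le_rfl]
        exact hY
      rw [restr_apply_of_eq hj, restr_apply_of_eq hj, Matrix.vecMul_sub, Matrix.vecMul_one,
        Pi.sub_apply, this, sub_zero]
    · rw [restr_apply_of_ne hj, restr_apply_of_ne hj]
  have hadd : u (k + m) = u k ᵥ* (1 + levelBlock h (Y h S ω) (E - 1)) ^ m :=
    obsVec_add E h μ hlev
  rw [gridFilter, gridFilter, e1]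
  change normMass (restr h (Y h S' ω) (normMass (u k) ᵥ* (1 + levelBlock h (Y h S ω) (E - 1)) ^ m
    ᵥ* ((δ : ℝ)⁻¹ • (E - 1)))) = normMass (u ⌈S' / δ⌉₊)
  rw [e2, normMass.eq_1 (u k), Matrix.smul_vecMul, Matrix.smul_vecMul,
    restr_smul, normMass_smul (inv_ne_zero hsum), ← hadd, Matrix.vecMul_smul,
    restr_smul, normMass_smul hδ']

end Limit

/-! ### Existence of the solution as the limit of the grid filters -/

section Existence

variable {I O : Type*}

/-- The path starts at a point charged by `μ` and only makes jumps with a positive rate. -/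
structure IsRegularPath (Λ : Matrix I I ℝ) (μ : I → ℝ) (ω : CadlagPath I) : Prop where
  init : 0 < μ (X 0 ω)
  jump : ∀ S S', S < S' → (∀ r ∈ Ico S S', X r ω = X S ω) →
    X S' ω = X S ω ∨ 0 < Λ (X S ω) (X S' ω)

lemma restr_init_nonneg_pos {Λ : Matrix I I ℝ} {h : I → O} {μ : I → ℝ}
    {ω : CadlagPath I} (hμ : ∀ i, 0 ≤ μ i) (hω : IsRegularPath Λ μ ω) :
    (∀ j, 0 ≤ restr h (Y h 0 ω) μ j) ∧ 0 < restr h (Y h 0 ω) μ (X 0 ω) := by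
  refine ⟨fun j => ?_, ?_⟩
  · by_cases hj : h j = Y h 0 ω
    · rw [restr_apply_of_eq hj]
      exact hμ j
    · rw [restr_apply_of_ne hj]
  · rw [restr_apply_of_eq (show h (X 0 ω) = Y h 0 ω from rfl)]
    exact hω.init

variable [Fintype I]

/-- The properties of the filter that are propagated along a path whose current position is `i`:
it is a probability vector on the level set of `i` that charges `i`. -/
structure IsFilterState (h : I → O) (i : I) (v : I → ℝ) : Prop where
  nonneg : ∀ j, 0 ≤ v j
  eq_zero : ∀ j, h j ≠ h i → v j = 0
  pos : 0 < v i
  sum_eq_one : ∑ j, v j = 1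

lemma sum_pos_of_pos {w : I → ℝ} (hw : ∀ j, 0 ≤ w j) {i : I} (hi : 0 < w i) : 0 < ∑ j, w j :=
  Finset.sum_pos' (fun j _ => hw j) ⟨i, Finset.mem_univ i, hi⟩

lemma isFilterState_normMass {h : I → O} {i : I} {w : I → ℝ} (h1 : ∀ j, 0 ≤ w j)
    (h2 : ∀ j, h j ≠ h i → w j = 0) (h3 : 0 < w i) : IsFilterState h i (normMass w) := by
  have hs := sum_pos_of_pos h1 h3
  refine ⟨fun j => mul_nonneg (inv_nonneg.2 hs.le) (h1 j), fun j hj => ?_,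
    mul_pos (inv_pos.2 hs) h3, sum_normMass hs.ne'⟩
  simp [normMass, h2 j hj]

variable [DecidableEq I] {Λ : Matrix I I ℝ} {h : I → O} {μ : I → ℝ} {ω : CadlagPath I}
  {S S' : ℝ≥0} {v : I → ℝ}

lemma IsFilterState.sum_levelFlow_ne_zero {i : I} (hΛ : IsRateMatrix Λ) (hv : IsFilterState h i v)
    {τ : ℝ} (hτ : 0 ≤ τ) : ∑ j, levelFlow Λ h (h i) v τ j ≠ 0 := by
  rcases hτ.eq_or_lt with rfl | hτ
  · simp [levelFlow, NormedSpace.exp_zero, hv.sum_eq_one]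
  · exact (sum_pos_of_pos (levelFlow_nonneg hΛ _ hv.nonneg hτ.le)
      (levelFlow_pos hΛ hv.nonneg hτ hv.pos (Or.inl rfl))).ne'

lemma IsRegularPath.state_no_jump (hΛ : IsRateMatrix Λ) (hω : IsRegularPath Λ μ ω) (hSS : S < S')
    (hc : ∀ r ∈ Ico S S', X r ω = X S ω) (hY : Y h S' ω = Y h S ω)
    (hv : IsFilterState h (X S ω) v) :
    IsFilterState h (X S' ω) (normMass (levelFlow Λ h (Y h S ω) v (S' - S))) := by
  have hτ : (0 : ℝ) < S' - S := sub_pos.2 (NNReal.coe_lt_coe.2 hSS)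
  refine isFilterState_normMass (levelFlow_nonneg hΛ _ hv.nonneg hτ.le) (fun j hj => ?_) ?_
  · exact levelFlow_eq_zero hv.eq_zero _ fun he => hj (he.trans hY.symm)
  · exact levelFlow_pos hΛ hv.nonneg hτ hv.pos
      ((hω.jump S S' hSS hc).imp id fun hp => ⟨hY, hp⟩)

lemma IsRegularPath.jump_nonneg_pos (hΛ : IsRateMatrix Λ) (hω : IsRegularPath Λ μ ω) (hSS : S < S')
    (hc : ∀ r ∈ Ico S S', X r ω = X S ω) (hY : Y h S' ω ≠ Y h S ω)
    (hv : IsFilterState h (X S ω) v) :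
    (∀ j, 0 ≤ restr h (Y h S' ω) (levelFlow Λ h (Y h S ω) v (S' - S) ᵥ* Λ) j) ∧
    0 < restr h (Y h S' ω) (levelFlow Λ h (Y h S ω) v (S' - S) ᵥ* Λ) (X S' ω) := by
  have hτ : (0 : ℝ) < S' - S := sub_pos.2 (NNReal.coe_lt_coe.2 hSS)
  set w := levelFlow Λ h (Y h S ω) v (S' - S) with hw
  -- The mass of `w` sits on the level set of `X S`, which `j` avoids, so no diagonal rate enters.
  have hnn : ∀ j, h j = Y h S' ω → ∀ i, 0 ≤ w i * Λ i j := by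
    intro j hj i
    by_cases hi : h i = Y h S ω
    · exact mul_nonneg (levelFlow_nonneg hΛ _ hv.nonneg hτ.le i)
        (hΛ.off_diag_nonneg i j fun he => hY (by rw [← hj, ← he, hi]))
    · have : w i = 0 := levelFlow_eq_zero hv.eq_zero _ hi
      rw [this, zero_mul]
  constructor
  · intro j
    by_cases hj : h j = Y h S' ω
    · rw [restr_apply_of_eq hj]
      exact Finset.sum_nonneg fun i _ => hnn j hj i
    · rw [restr_apply_of_ne hj]
  · rw [restr_apply_of_eq (show h (X S' ω) = Y h S' ω from rfl)]
    refine Finset.sum_pos' (fun i _ => hnn _ rfl i) ⟨X S ω, Finset.mem_univ _, mul_pos ?_ ?_⟩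
    · exact levelFlow_pos hΛ hv.nonneg hτ hv.pos (Or.inl rfl)
    · exact (hω.jump S S' hSS hc).resolve_left fun he => hY (by rw [Y, Y, he])

lemma IsRegularPath.state_jump (hΛ : IsRateMatrix Λ) (hω : IsRegularPath Λ μ ω) (hSS : S < S')
    (hc : ∀ r ∈ Ico S S', X r ω = X S ω) (hY : Y h S' ω ≠ Y h S ω)
    (hv : IsFilterState h (X S ω) v) : IsFilterState h (X S' ω)
      (normMass (restr h (Y h S' ω) (levelFlow Λ h (Y h S ω) v (S' - S) ᵥ* Λ))) := by
  obtain ⟨h1, h2⟩ := hω.jump_nonneg_pos hΛ hSS hc hY hv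
  exact isFilterState_normMass h1 (fun j hj => restr_apply_of_ne hj _) h2

/-- One step of the construction, from `S` to `S'`, with the value of the limit at `S'`. -/
lemma IsRegularPath.gridLimit_step (hΛ : IsRateMatrix Λ) (hω : IsRegularPath Λ μ ω) (hSS : S < S')
    (hc : ∀ r ∈ Ico S S', X r ω = X S ω) (hS : GridLimit Λ h μ ω S v)
    (hv : IsFilterState h (X S ω) v) :
    (Y h S' ω = Y h S ω →
      GridLimit Λ h μ ω S' (normMass (levelFlow Λ h (Y h S ω) v (S' - S)))) ∧
    (Y h S' ω ≠ Y h S ω → GridLimit Λ h μ ω S'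
      (normMass (restr h (Y h S' ω) (levelFlow Λ h (Y h S ω) v (S' - S) ᵥ* Λ)))) := by
  have hτ : (0 : ℝ) ≤ S' - S := sub_nonneg.2 (NNReal.coe_le_coe.2 hSS.le)
  have : Nonempty I := ⟨X S ω⟩
  refine ⟨fun hY => hS.step_no_jump hv.sum_eq_one hSS hc hY (hv.sum_levelFlow_ne_zero hΛ hτ),
    fun hY => ?_⟩
  obtain ⟨h1, h2⟩ := hω.jump_nonneg_pos hΛ hSS hc hY hv
  exact hS.step_jump hv.sum_eq_one hSS hc hY (sum_pos_of_pos h1 h2).ne'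

lemma gridLimit_zero (Λ : Matrix I I ℝ) (h : I → O) (μ : I → ℝ) (ω : CadlagPath I) :
    GridLimit Λ h μ ω 0 (normMass (restr h (Y h 0 ω) μ)) := by
  refine tendsto_const_nhds.congr fun δ => ?_
  simp [gridFilter, obsVec]

lemma IsRegularPath.exists_gridLimit (hΛ : IsRateMatrix Λ) (hμ : ∀ i, 0 ≤ μ i)
    (hω : IsRegularPath Λ μ ω) (t : ℝ≥0) :
    ∃ v, GridLimit Λ h μ ω t v ∧ IsFilterState h (X t ω) v := by
  refine ω.path_induction (G := fun t => ∃ v, GridLimit Λ h μ ω t v ∧ IsFilterState h (X t ω) v)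
    ⟨_, gridLimit_zero Λ h μ ω, ?_⟩ ?_ t
  · obtain ⟨h1, h2⟩ := restr_init_nonneg_pos (h := h) hμ hω
    exact isFilterState_normMass h1 (fun j hj => restr_apply_of_ne hj _) h2
  · rintro S S' hSS hc ⟨v, hS, hv⟩
    by_cases hY : Y h S' ω = Y h S ω
    · exact ⟨_, (hω.gridLimit_step hΛ hSS hc hS hv).1 hY, hω.state_no_jump hΛ hSS hc hY hv⟩
    · exact ⟨_, (hω.gridLimit_step hΛ hSS hc hS hv).2 hY, hω.state_jump hΛ hSS hc hY hv⟩

/-- Along a regular path the grid filters converge, and their limit solves the filtering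
equation. -/
theorem IsRegularPath.exists_isFilterSolution (hΛ : IsRateMatrix Λ) {μ : stdSimplex ℝ I}
    (hω : IsRegularPath Λ μ.1 ω) (ν : O → I → ℝ) :
    ∃ p, IsFilterSolution Λ h ν μ ω p ∧ ∀ t, GridLimit Λ h μ.1 ω t (p t) := by
  choose p hp hst using hω.exists_gridLimit (h := h) hΛ μ.2.1
  have huniq : ∀ {t v}, GridLimit Λ h μ.1 ω t v → p t = v := fun hv =>
    tendsto_nhds_unique (hp _) hv
  have hflow : ∀ S S', (∀ r ∈ Ico S S', X r ω = X S ω) → ∀ r ∈ Ico S S',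
      p r = normMass (levelFlow Λ h (Y h S ω) (p S) (r - S)) := by
    rintro S S' hc r ⟨h1, h2⟩
    rcases h1.eq_or_lt with rfl | h1
    · simp [levelFlow, NormedSpace.exp_zero, normMass_of_sum_eq_one (hst S).sum_eq_one]
    · exact huniq ((hω.gridLimit_step hΛ h1 (fun x hx => hc x ⟨hx.1, hx.2.trans h2⟩) (hp S)
        (hst S)).1 (by rw [Y, Y, hc r ⟨h1.le, h2⟩]))
  have hcont : ∀ S : ℝ≥0, ∀ x : ℝ, S ≤ x → HasDerivAt
      (fun x : ℝ => normMass (levelFlow Λ h (Y h S ω) (p S) (x - S)))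
      (filterField Λ h (Y h S ω) (normMass (levelFlow Λ h (Y h S ω) (p S) (x - S)))) x := by
    intro S x hx
    exact (hasDerivAt_normMass_levelFlow (hst S).eq_zero
      ((hst S).sum_levelFlow_ne_zero hΛ (sub_nonneg.2 hx))).comp_sub_const x S
  have hleft : ∀ S S', S < S' → (∀ r ∈ Ico S S', X r ω = X S ω) →
      Tendsto p (𝓝[<] S') (𝓝 (normMass (levelFlow Λ h (Y h S ω) (p S) (S' - S)))) := by
    intro S S' hSS hc
    have h1 := (hcont S S' (NNReal.coe_le_coe.2 hSS.le)).continuousAt.tendsto.comp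
      ((NNReal.continuous_coe.tendsto S').mono_left (nhdsWithin_le_nhds (s := Iio S')))
    refine h1.congr' ?_
    filter_upwards [Ico_mem_nhdsLT hSS] with r hr
    exact (hflow S S' hc r hr).symm
  have hleftLim : ∀ S S', S < S' → (∀ r ∈ Ico S S', X r ω = X S ω) →
      Function.leftLim p S' = normMass (levelFlow Λ h (Y h S ω) (p S) (S' - S)) := by
    intro S S' hSS hc
    have := nnreal_nhdsLT_neBot (zero_le.trans_lt hSS)
    exact leftLim_eq_of_tendsto (hleft S S' hSS hc)
  refine ⟨p, isFilterSolution_of_steps ?_ ?_ ?_ ?_ ?_ ?_, hp⟩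
  · intro t
    obtain ⟨u, hu, hc⟩ := ω.exists_const_right t
    have h1 := (hcont t t le_rfl).continuousAt.tendsto.comp
      ((NNReal.continuous_coe.tendsto t).mono_left (nhdsWithin_le_nhds (s := Ici t)))
    have e : p t = normMass (levelFlow Λ h (Y h t ω) (p t) (t - t)) :=
      hflow t u hc t ⟨le_rfl, hu⟩
    rw [ContinuousWithinAt, e]
    refine h1.congr' ?_
    filter_upwards [Ico_mem_nhdsGE hu] with r hr
    exact (hflow t u hc r hr).symm
  · intro t ht
    obtain ⟨S, hS, hc⟩ := ω.exists_const_left ht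
    exact ⟨_, hleft S t hS (hc S ⟨le_rfl, hS⟩)⟩
  · have h2 := (restr_init_nonneg_pos (h := h) μ.2.1 hω)
    rw [opH_eq_normMass (sum_pos_of_pos h2.1 h2.2).ne']
    exact huniq (gridLimit_zero Λ h μ.1 ω)
  · intro S S' hSS hc i
    have hle : (S : ℝ) ≤ S' := NNReal.coe_le_coe.2 hSS.le
    rw [hleftLim S S' hSS hc]
    set φ : ℝ → I → ℝ := fun x => normMass (levelFlow Λ h (Y h S ω) (p S) (x - S)) with hφ
    have hint : ∫ x in (S : ℝ)..S', filterField Λ h (Y h S ω) (φ x) i = φ S' i - φ S i := by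
      refine intervalIntegral.integral_eq_sub_of_hasDerivAt (f := fun x => φ x i)
        (fun x hx => ?_) (ContinuousOn.intervalIntegrable fun x hx => ?_)
      · rw [uIcc_of_le hle] at hx
        exact hasDerivAt_pi.1 (hcont S x hx.1) i
      · rw [uIcc_of_le hle] at hx
        exact (((continuous_apply i).comp
          (contDiff_filterField Λ h (Y h S ω)).continuous).continuousAt.comp
            (hcont S x hx.1).continuousAt).continuousWithinAt
    have hdr : drift Λ h ω p S S' i = φ S' i - φ S i := by
      rw [← hint]
      refine intervalIntegral.integral_congr_ae ?_
      filter_upwards [Measure.ae_ne volume (S' : ℝ)] with x hx hxI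
      rw [uIoc_of_le hle] at hxI
      have hx0 : 0 ≤ x := S.2.trans hxI.1.le
      have hmem : x.toNNReal ∈ Ico S S' := ⟨NNReal.le_toNNReal_of_coe_le hxI.1.le,
        (Real.toNNReal_lt_iff_lt_coe hx0).2 (lt_of_le_of_ne hxI.2 hx)⟩
      have hY : Y h x.toNNReal ω = Y h S ω := by rw [Y, Y, hc _ hmem]
      rw [hY, hflow S S' hc _ hmem, Real.coe_toNNReal x hx0]
    have hφS : φ S = p S := (hflow S S' hc S ⟨le_rfl, hSS⟩).symm
    rw [hdr, hφS, add_sub_cancel]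
  · intro S S' hSS hc hY
    rw [hleftLim S S' hSS hc]
    exact huniq ((hω.gridLimit_step hΛ hSS hc (hp S) (hst S)).1 hY)
  · intro S S' hSS hc hY
    obtain ⟨h1, h2⟩ := hω.jump_nonneg_pos hΛ hSS hc hY (hst S)
    have hm : ∑ j, levelFlow Λ h (Y h S ω) (p S) (S' - S) j ≠ 0 :=
      (hst S).sum_levelFlow_ne_zero hΛ (sub_nonneg.2 (NNReal.coe_le_coe.2 hSS.le))
    have e : restr h (Y h S' ω) (normMass (levelFlow Λ h (Y h S ω) (p S) (S' - S)) ᵥ* Λ) =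
        (∑ i, levelFlow Λ h (Y h S ω) (p S) (S' - S) i)⁻¹ •
          restr h (Y h S' ω) (levelFlow Λ h (Y h S ω) (p S) (S' - S) ᵥ* Λ) := by
      rw [normMass, Matrix.smul_vecMul, restr_smul]
    rw [hleftLim S S' hSS hc, opH_eq_normMass, e, normMass_smul (inv_ne_zero hm)]
    · exact huniq ((hω.gridLimit_step hΛ hSS hc (hp S) (hst S)).2 hY)
    · rw [e]
      simp only [Pi.smul_apply, smul_eq_mul, ← Finset.mul_sum]
      exact mul_ne_zero (inv_ne_zero hm) (sum_pos_of_pos h1 h2).ne'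

end Existence

/-! ### The Markov property on path space -/

section Markov

variable {I O : Type*}

lemma measurableSet_chainSigma {s t : ℝ≥0} (hst : s ≤ t) (B : Set I) :
    MeasurableSet[chainSigma I t] (X s ⁻¹' B) := by
  have hle : MeasurableSpace.comap (X s) ⊤ ≤ chainSigma I t :=
    le_iSup₂_of_le (f := fun (s : ℝ≥0) (_ : s ∈ Icc 0 t) =>
      MeasurableSpace.comap (X (I := I) s) ⊤) s ⟨zero_le, hst⟩ le_rfl
  exact hle _ ⟨B, trivial, rfl⟩

lemma measurableSet_X_preimage (s : ℝ≥0) (B : Set I) :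
    MeasurableSet (X s ⁻¹' B : Set (CadlagPath I)) :=
  le_iSup (fun s : ℝ≥0 => MeasurableSpace.comap (X (I := I) s) ⊤) s _ ⟨B, trivial, rfl⟩

lemma chainSigma_le (t : ℝ≥0) : chainSigma I t ≤ CadlagPath.instMeasurableSpace :=
  iSup₂_le fun s _ => le_iSup (fun s : ℝ≥0 => MeasurableSpace.comap (X (I := I) s) ⊤) s

lemma chainSigma_mono {s t : ℝ≥0} (hst : s ≤ t) : chainSigma I s ≤ chainSigma I t := by
  refine iSup₂_le fun r hr => ?_
  exact le_iSup₂_of_le (f := fun (s : ℝ≥0) (_ : s ∈ Icc 0 t) =>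
      MeasurableSpace.comap (X (I := I) s) ⊤) r ⟨hr.1, hr.2.trans hst⟩ le_rfl

lemma measurableSet_obsSigma (h : I → O) {s t : ℝ≥0} (hst : s ≤ t) (B : Set O) :
    MeasurableSet[obsSigma h t] (Y h s ⁻¹' B) := by
  have hle : MeasurableSpace.comap (Y h s) ⊤ ≤ obsSigma h t :=
    le_iSup₂_of_le (f := fun (s : ℝ≥0) (_ : s ∈ Icc 0 t) =>
      MeasurableSpace.comap (Y h s) ⊤) s ⟨zero_le, hst⟩ le_rfl
  exact hle _ ⟨B, trivial, rfl⟩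

lemma obsSigma_le_chainSigma (h : I → O) (t : ℝ≥0) : obsSigma h t ≤ chainSigma I t := by
  refine iSup₂_le fun s hs => ?_
  rintro _ ⟨B, -, rfl⟩
  exact measurableSet_chainSigma hs.2 (h ⁻¹' B)

lemma measurable_shift (t : ℝ≥0) : Measurable (shift (I := I) t) := by
  refine measurable_iff_comap_le.2 ?_
  rw [CadlagPath.instMeasurableSpace, MeasurableSpace.comap_iSup]
  refine iSup_le fun s => ?_
  rw [MeasurableSpace.comap_comp]
  rintro _ ⟨B, -, rfl⟩
  exact measurableSet_X_preimage (t + s) B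

variable [Fintype I]

lemma sum_real_inter_X (P : Measure (CadlagPath I)) [IsFiniteMeasure P] (s : ℝ≥0)
    (C : Set (CadlagPath I)) : ∑ j, P.real (C ∩ X s ⁻¹' {j}) = P.real C := by
  have := sum_measureReal_preimage_singleton (μ := P.restrict C) Finset.univ (f := X (I := I) s)
    fun j _ => measurableSet_X_preimage s {j}
  simp only [measureReal_restrict_apply (measurableSet_X_preimage s _)] at this
  simpa [inter_comm] using this

variable [DecidableEq I] {Λ : Matrix I I ℝ} {μ : stdSimplex ℝ I} {P : Measure (CadlagPath I)}

/-- The Markov property for one-dimensional marginals, in integrated form. -/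
lemma IsChainLaw.real_inter_inter (hP : IsChainLaw Λ μ P) {t : ℝ≥0} {A : Set (CadlagPath I)}
    (hA : MeasurableSet[chainSigma I t] A) (s : ℝ≥0) (i j : I) :
    P.real (A ∩ X t ⁻¹' {i} ∩ X (t + s) ⁻¹' {j}) =
      P.real (A ∩ X t ⁻¹' {i}) * NormedSpace.exp ((s : ℝ) • Λ) i j := by
  have := hP.isProbabilityMeasure
  have hC : MeasurableSet[chainSigma I t] (A ∩ X t ⁻¹' {i}) :=
    hA.inter (measurableSet_chainSigma le_rfl {i})
  have hC' := chainSigma_le t _ hC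
  have hf : (fun ω => (Pi.single j (1 : ℝ) : I → ℝ) (X (t + s) ω)) =
      (X (t + s) ⁻¹' {j}).indicator fun _ => (1 : ℝ) := by
    ext ω
    by_cases hω : X (t + s) ω = j
    · simp [hω]
    · simp [hω]
  have hint : Integrable (fun ω => (Pi.single j (1 : ℝ) : I → ℝ) (X (t + s) ω)) P := by
    rw [hf]
    exact (integrable_const (1 : ℝ)).indicator (measurableSet_X_preimage _ _)
  have h1 := setIntegral_condExp (chainSigma_le t) hint hC
  rw [setIntegral_congr_ae (g := fun _ => NormedSpace.exp ((s : ℝ) • Λ) i j) hC', hf,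
    setIntegral_indicator (measurableSet_X_preimage _ _), setIntegral_const, setIntegral_const,
    smul_eq_mul, smul_eq_mul, mul_one] at h1
  · exact h1.symm
  · filter_upwards [hP.markov t s (Pi.single j 1)] with ω hω hωC
    rw [hω, show X t ω = i from hωC.2, Matrix.mulVec_single_one]
    rfl

/-- The probability of a cylinder set of the future, given the past and the present, does not
depend on the initial law, on the past or on the present time. -/
lemma exists_cylinder_weight (Λ : Matrix I I ℝ) (F : Finset ℝ≥0) (B : ℝ≥0 → Set I) :
    ∀ (u : ℝ≥0), (∀ s ∈ F, u ≤ s) → ∀ i : I, ∃ w : ℝ, ∀ (μ : stdSimplex ℝ I)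
      (P : Measure (CadlagPath I)), IsChainLaw Λ μ P → ∀ (t : ℝ≥0) (A : Set (CadlagPath I)),
      MeasurableSet[chainSigma I (t + u)] A →
      P.real (A ∩ X (t + u) ⁻¹' {i} ∩ ⋂ s ∈ F, X (t + s) ⁻¹' B s) =
        P.real (A ∩ X (t + u) ⁻¹' {i}) * w := by
  classical
  induction F using Finset.induction_on_min with
  | empty => exact fun u _ i => ⟨1, fun μ P _ t A _ => by simp⟩
  | insert r F hr ih =>
    intro u hu i
    choose w hw using ih r fun s hs => (hr s hs).le
    have hur : u ≤ r := hu r (Finset.mem_insert_self r F)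
    refine ⟨∑ j, if j ∈ B r then NormedSpace.exp (((r - u : ℝ≥0) : ℝ) • Λ) i j * w j else 0,
      fun μ P hP t A hA => ?_⟩
    have := hP.isProbabilityMeasure
    have htr : t + u + (r - u) = t + r := by rw [add_assoc, add_tsub_cancel_of_le hur]
    have hA' : MeasurableSet[chainSigma I (t + r)] (A ∩ X (t + u) ⁻¹' {i}) := by
      have htur : t + u ≤ t + r := by gcongr
      exact (chainSigma_mono htur _ hA).inter (measurableSet_chainSigma htur _)
    rw [← sum_real_inter_X P (t + r), Finset.mul_sum]
    refine Finset.sum_congr rfl fun j _ => ?_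
    rw [Finset.set_biInter_insert]
    split_ifs with hj
    · have e : A ∩ X (t + u) ⁻¹' {i} ∩ (X (t + r) ⁻¹' B r ∩ ⋂ s ∈ F, X (t + s) ⁻¹' B s) ∩
          X (t + r) ⁻¹' {j} =
          A ∩ X (t + u) ⁻¹' {i} ∩ X (t + r) ⁻¹' {j} ∩ ⋂ s ∈ F, X (t + s) ⁻¹' B s := by
        ext ω
        simp only [mem_inter_iff, mem_preimage, mem_singleton_iff]
        constructor
        · rintro ⟨⟨h1, -, h2⟩, h3⟩
          exact ⟨⟨h1, h3⟩, h2⟩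
        · rintro ⟨⟨h1, h3⟩, h2⟩
          exact ⟨⟨h1, by rwa [h3], h2⟩, h3⟩
      have h1 := hP.real_inter_inter hA (r - u) i j
      rw [htr] at h1
      rw [e, hw j μ P hP t _ hA', h1, mul_assoc]
    · have e : A ∩ X (t + u) ⁻¹' {i} ∩ (X (t + r) ⁻¹' B r ∩ ⋂ s ∈ F, X (t + s) ⁻¹' B s) ∩
          X (t + r) ⁻¹' {j} = ∅ := by
        refine eq_empty_of_forall_notMem ?_
        rintro ω ⟨⟨-, h1, -⟩, h2⟩
        rw [mem_preimage, mem_preimage.1 h2] at h1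
        exact hj h1
      rw [e, measureReal_empty, mul_zero]

lemma IsChainLaw.ae_X_zero {i : I} {Q : Measure (CadlagPath I)}
    (hQ : IsChainLaw Λ (diracPt i) Q) : ∀ᵐ ω ∂Q, X 0 ω = i := by
  have := hQ.isProbabilityMeasure
  have h1 : Q.real (X 0 ⁻¹' {i}) = 1 := (hQ.initial i).trans (by simp [diracPt])
  have h2 : Q (X 0 ⁻¹' {i}) = 1 := by
    rw [← ofReal_measureReal, h1, ENNReal.ofReal_one]
  have := (prob_compl_eq_zero_iff (measurableSet_X_preimage 0 {i})).2 h2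
  exact this

/-- The Markov property for arbitrary events of the future, in integrated form. Both sides are
finite measures in `Γ` that agree on the π-system of cylinder sets. -/
lemma IsChainLaw.real_inter_shift (hP : IsChainLaw Λ μ P) {i : I} {Q : Measure (CadlagPath I)}
    (hQ : IsChainLaw Λ (diracPt i) Q) {t : ℝ≥0} {A : Set (CadlagPath I)}
    (hA : MeasurableSet[chainSigma I t] A) {Γ : Set (CadlagPath I)} (hΓ : MeasurableSet Γ) :
    P.real (A ∩ X t ⁻¹' {i} ∩ shift t ⁻¹' Γ) = P.real (A ∩ X t ⁻¹' {i}) * Q.real Γ := by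
  have := hP.isProbabilityMeasure
  have := hQ.isProbabilityMeasure
  set C := A ∩ X t ⁻¹' {i} with hC
  have key : (P.restrict C).map (shift t) = P C • Q := by
    have hgen : (CadlagPath.instMeasurableSpace : MeasurableSpace (CadlagPath I)) =
        MeasurableSpace.generateFrom (piiUnionInter
          (fun s : ℝ≥0 => {D | MeasurableSet[MeasurableSpace.comap (X (I := I) s) ⊤] D}) univ) := by
      rw [generateFrom_piiUnionInter_measurableSet
        (fun s : ℝ≥0 => MeasurableSpace.comap (X (I := I) s) ⊤) univ]
      simp [CadlagPath.instMeasurableSpace]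
    refine ext_of_generate_finite _ hgen (isPiSystem_piiUnionInter _
      (fun s => @MeasurableSpace.isPiSystem_measurableSet _
        (MeasurableSpace.comap (X (I := I) s) ⊤)) _) ?_ ?_
    · rintro D ⟨F, -, f, hf, rfl⟩
      have hB : ∀ s : ℝ≥0, ∃ B : Set I, s ∈ F → X s ⁻¹' B = f s := by
        intro s
        by_cases hs : s ∈ F
        · obtain ⟨B, -, hB⟩ := hf s hs
          exact ⟨B, fun _ => hB⟩
        · exact ⟨∅, fun h => absurd h hs⟩
      choose B hB using hB
      have hD : ⋂ s ∈ F, f s = ⋂ s ∈ F, X s ⁻¹' B s :=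
        iInter₂_congr fun s hs => (hB s hs).symm
      have hDm : MeasurableSet (⋂ s ∈ F, X s ⁻¹' B s : Set (CadlagPath I)) :=
        Finset.measurableSet_biInter F fun s _ => measurableSet_X_preimage s (B s)
      obtain ⟨w, hw⟩ := exists_cylinder_weight Λ F B 0 (fun _ _ => zero_le) i
      have h1 := hw μ P hP t A (by rwa [add_zero])
      have h2 := hw (diracPt i) Q hQ 0 univ MeasurableSet.univ
      rw [add_zero, ← hC] at h1
      simp only [zero_add, univ_inter] at h2
      have hX0 : Q.real (X 0 ⁻¹' {i}) = 1 := (hQ.initial i).trans (by simp [diracPt])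
      have h3 : Q.real (X 0 ⁻¹' {i} ∩ ⋂ s ∈ F, X s ⁻¹' B s) = Q.real (⋂ s ∈ F, X s ⁻¹' B s) := by
        refine measureReal_congr ?_
        filter_upwards [hQ.ae_X_zero] with ω hω
        exact propext ⟨fun h => h.2, fun h => ⟨hω, h⟩⟩
      rw [h3, hX0, one_mul] at h2
      rw [hD, Measure.map_apply (measurable_shift t) hDm,
        Measure.restrict_apply (measurable_shift t hDm), Measure.smul_apply, smul_eq_mul,
        ← ENNReal.toReal_eq_toReal_iff' (measure_ne_top _ _)
          (ENNReal.mul_ne_top (measure_ne_top _ _) (measure_ne_top _ _)), ENNReal.toReal_mul]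
      have e : shift t ⁻¹' (⋂ s ∈ F, X s ⁻¹' B s) ∩ C = C ∩ ⋂ s ∈ F, X (t + s) ⁻¹' B s := by
        rw [inter_comm, preimage_iInter₂]
        rfl
      rw [e]
      change P.real _ = P.real C * Q.real _
      rw [h1, h2]
    · rw [Measure.map_apply (measurable_shift t) MeasurableSet.univ]
      simp
  have h1 := congrArg (fun M : Measure (CadlagPath I) => M.real Γ) key
  simp only [Measure.real, Measure.map_apply (measurable_shift t) hΓ,
    Measure.restrict_apply (measurable_shift t hΓ), Measure.smul_apply, smul_eq_mul,
    ENNReal.toReal_mul] at h1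
  rw [inter_comm]
  exact h1

/-- The Markov property for arbitrary events of the future. -/
lemma IsChainLaw.condExp_shift (hP : IsChainLaw Λ μ P) {Q : I → Measure (CadlagPath I)}
    (hQ : ∀ i, IsChainLaw Λ (diracPt i) (Q i)) (t : ℝ≥0) {Γ : Set (CadlagPath I)}
    (hΓ : MeasurableSet Γ) : P⟦shift t ⁻¹' Γ | chainSigma I t⟧ =ᵐ[P]
      ∑ i, (Q i).real Γ • (X t ⁻¹' {i}).indicator fun _ => (1 : ℝ) := by
  have := hP.isProbabilityMeasure
  have hint : ∀ i, Integrable ((Q i).real Γ • (X t ⁻¹' {i}).indicator fun _ => (1 : ℝ)) P :=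
    fun i => ((integrable_const (1 : ℝ)).indicator (measurableSet_X_preimage _ _)).smul _
  have hΓ' := measurable_shift t hΓ
  refine (ae_eq_condExp_of_forall_setIntegral_eq (chainSigma_le t)
    ((integrable_const (1 : ℝ)).indicator hΓ') (fun A _ _ => (integrable_finsetSum' _
      fun i _ => hint i).integrableOn) (fun A hA _ => ?_) ?_).symm
  · rw [setIntegral_indicator hΓ', setIntegral_const, smul_eq_mul, mul_one]
    simp only [Finset.sum_apply]
    rw [integral_finsetSum _ fun i _ => (hint i).integrableOn]
    rw [← sum_real_inter_X P t]
    refine Finset.sum_congr rfl fun i _ => ?_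
    simp only [Pi.smul_apply, integral_smul]
    rw [setIntegral_indicator (measurableSet_X_preimage _ _), setIntegral_const, smul_eq_mul,
      smul_eq_mul, mul_one, inter_right_comm, hP.real_inter_shift (hQ i) hA hΓ, mul_comm]
  · refine StronglyMeasurable.aestronglyMeasurable ?_
    refine Finset.stronglyMeasurable_sum _ fun i _ => ?_
    exact (stronglyMeasurable_const.indicator (measurableSet_chainSigma le_rfl _)).const_smul _

/-- Conditioning a future event on the observations reduces to conditioning the present state. -/
lemma IsChainLaw.condExp_shift_obsSigma (hP : IsChainLaw Λ μ P) {Q : I → Measure (CadlagPath I)}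
    (hQ : ∀ i, IsChainLaw Λ (diracPt i) (Q i)) (h : I → O) (t : ℝ≥0) {Γ : Set (CadlagPath I)}
    (hΓ : MeasurableSet Γ) : P⟦shift t ⁻¹' Γ | obsSigma h t⟧ =ᵐ[P]
      fun ω => ∑ i, (Q i).real Γ * (P⟦X t ⁻¹' {i} | obsSigma h t⟧) ω := by
  have := hP.isProbabilityMeasure
  have h1 := condExp_condExp_of_le (μ := P) (f := (shift t ⁻¹' Γ).indicator fun _ => (1 : ℝ))
    (obsSigma_le_chainSigma h t) (chainSigma_le t)
  have h2 := condExp_congr_ae (m := obsSigma h t) (hP.condExp_shift hQ t hΓ)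
  have h3 := condExp_finsetSum (μ := P) (s := Finset.univ)
    (f := fun i => (Q i).real Γ • (X t ⁻¹' {i}).indicator fun _ => (1 : ℝ))
    (fun i _ => ((integrable_const (1 : ℝ)).indicator (measurableSet_X_preimage t {i})).smul _)
    (obsSigma h t)
  have h4 : ∀ᵐ ω ∂P, ∀ i, (P[(Q i).real Γ • (X t ⁻¹' {i}).indicator fun _ => (1 : ℝ) |
      obsSigma h t]) ω = (Q i).real Γ * (P⟦X t ⁻¹' {i} | obsSigma h t⟧) ω := by
    refine ae_all_iff.2 fun i => ?_
    exact condExp_smul ((Q i).real Γ) _ _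
  filter_upwards [h1, h2, h3, h4] with ω h1 h2 h3 h4
  rw [← h1, h2, h3, Finset.sum_apply]
  exact Finset.sum_congr rfl fun i _ => h4 i

end Markov

/-! ### Almost every path is regular -/

section Regular

variable {I : Type*}

/-- The paths that move from `i` to `j` in one of the first `N` steps of the grid of mesh `δ`. -/
def gridTransition (i j : I) (δ : ℝ≥0) (N : ℕ) : Set (CadlagPath I) :=
  ⋃ k ∈ Finset.range N, X (k * δ) ⁻¹' {i} ∩ X (k * δ + δ) ⁻¹' {j}

/-- A jump of the path is seen by every sufficiently fine grid. -/
lemma eventually_mem_gridTransition {ω : CadlagPath I} {S S' M : ℝ≥0} (hSS : S < S') (hM : S' ≤ M)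
    (hc : ∀ r ∈ Ico S S', X r ω = X S ω) :
    ∀ᶠ δ in 𝓝[>] 0, ω ∈ gridTransition (X S ω) (X S' ω) δ ⌈M / δ⌉₊ := by
  filter_upwards [eventually_ceil_lt_ceil hSS, eventually_Y_ceil id ω S', self_mem_nhdsWithin]
    with δ hlt hX hδ
  obtain ⟨k, hk⟩ : ∃ k, ⌈S' / δ⌉₊ = k + 1 := ⟨⌈S' / δ⌉₊ - 1, by omega⟩
  have hkM : k < ⌈M / δ⌉₊ := by
    have : ⌈S' / δ⌉₊ ≤ ⌈M / δ⌉₊ := Nat.ceil_mono (by gcongr)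
    omega
  refine mem_iUnion₂.2 ⟨k, Finset.mem_range.2 hkM, ?_, ?_⟩
  · exact hc _ (mem_Ico_of_ceil_le hδ (by omega) (by omega))
  · rw [hk] at hX
    have e : ((k + 1 : ℕ) : ℝ≥0) * δ = k * δ + δ := by push_cast; ring
    rw [e] at hX
    exact hX

variable [Fintype I] [DecidableEq I] {Λ : Matrix I I ℝ} {μ : stdSimplex ℝ I}
  {P : Measure (CadlagPath I)}

lemma IsChainLaw.ae_init_pos (hP : IsChainLaw Λ μ P) : ∀ᵐ ω ∂P, 0 < μ.1 (X 0 ω) := by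
  have := hP.isProbabilityMeasure
  have h1 : ∀ᵐ ω ∂P, ∀ i, X 0 ω = i → 0 < μ.1 i := by
    refine ae_all_iff.2 fun i => ?_
    rcases (μ.2.1 i).eq_or_lt with hi | hi
    · have h0 : P.real {ω | X 0 ω = i} = 0 := (hP.initial i).trans hi.symm
      rw [measureReal_eq_zero_iff] at h0
      have : ∀ᵐ ω ∂P, ¬ X 0 ω = i := by
        rw [ae_iff]
        simpa using h0
      filter_upwards [this] with ω hω hωi using absurd hωi hω
    · exact Eventually.of_forall fun ω _ => hi
  filter_upwards [h1] with ω hω using hω _ rfl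

lemma IsRateMatrix.exp_nonneg (hΛ : IsRateMatrix Λ) (δ : ℝ≥0) (i j : I) :
    0 ≤ NormedSpace.exp ((δ : ℝ) • Λ) i j :=
  exp_smul_apply_nonneg hΛ.off_diag_nonneg δ.2 i j

lemma IsChainLaw.real_gridTransition_le (hP : IsChainLaw Λ μ P) (hΛ : IsRateMatrix Λ) (i j : I)
    (δ : ℝ≥0) (N : ℕ) :
    P.real (gridTransition i j δ N) ≤ N * NormedSpace.exp ((δ : ℝ) • Λ) i j := by
  have := hP.isProbabilityMeasure
  refine (measureReal_biUnion_finset_le _ _).trans ?_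
  refine (Finset.sum_le_card_nsmul _ _ (NormedSpace.exp ((δ : ℝ) • Λ) i j) fun k _ => ?_).trans
    (by simp)
  have := hP.real_inter_inter (t := k * δ) MeasurableSet.univ δ i j
  rw [univ_inter] at this
  rw [this]
  exact mul_le_of_le_one_left (hΛ.exp_nonneg δ i j) measureReal_le_one

lemma IsChainLaw.tendsto_real_gridTransition (hP : IsChainLaw Λ μ P) (hΛ : IsRateMatrix Λ)
    {i j : I} (hij : i ≠ j) (h0 : Λ i j = 0) (M : ℝ≥0) :
    Tendsto (fun δ => P.real (gridTransition i j δ ⌈M / δ⌉₊)) (𝓝[>] 0) (𝓝 0) := by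
  have h1 : Tendsto (fun δ : ℝ≥0 => (⌈M / δ⌉₊ * δ : ℝ)) (𝓝[>] 0) (𝓝 (M : ℝ)) :=
    ((NNReal.continuous_coe.tendsto M).comp
      ((tendsto_ceil_mul M).mono_right nhdsWithin_le_nhds)).congr fun δ => by simp
  have h2 := tendsto_pi_nhds.1 (tendsto_pi_nhds.1 (matrix_tendsto_exp_sub_one Λ) i) j
  have h3 := h1.mul h2
  rw [h0, mul_zero] at h3
  refine squeeze_zero' (Eventually.of_forall fun δ => measureReal_nonneg) ?_ h3
  filter_upwards [self_mem_nhdsWithin] with δ hδ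
  refine (hP.real_gridTransition_le hΛ i j δ _).trans (le_of_eq ?_)
  have hδ' : (δ : ℝ) ≠ 0 := NNReal.coe_ne_zero.2 (ne_of_gt hδ)
  simp only [Matrix.smul_apply, Matrix.sub_apply, Matrix.one_apply_ne hij, smul_eq_mul, sub_zero]
  field_simp

lemma tendsto_inv_succ_nhdsGT : Tendsto (fun n : ℕ => 1 / ((n : ℝ≥0) + 1)) atTop (𝓝[>] 0) :=
  tendsto_nhdsWithin_iff.2 ⟨tendsto_one_div_add_atTop_nhds_zero_nat,
    Eventually.of_forall fun n => by simp only [mem_Ioi]; positivity⟩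

/-- Almost surely no jump has rate `0`: at mesh `δ` such a transition has probability `o(δ)` in each
of the `O(δ⁻¹)` steps of the grid. -/
lemma IsChainLaw.ae_jump_pos (hP : IsChainLaw Λ μ P) (hΛ : IsRateMatrix Λ) :
    ∀ᵐ ω ∂P, ∀ S S', S < S' → (∀ r ∈ Ico S S', X r ω = X S ω) →
      X S' ω = X S ω ∨ 0 < Λ (X S ω) (X S' ω) := by
  have := hP.isProbabilityMeasure
  have key : ∀ᵐ ω ∂P, ∀ (i j : I) (M : ℕ), i ≠ j → Λ i j = 0 →
      ¬ ∀ᶠ n : ℕ in atTop, ω ∈ gridTransition i j (1 / ((n : ℝ≥0) + 1))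
        ⌈(M : ℝ≥0) / (1 / ((n : ℝ≥0) + 1))⌉₊ := by
    refine ae_all_iff.2 fun i => ae_all_iff.2 fun j => ae_all_iff.2 fun M => ?_
    by_cases hij : i ≠ j ∧ Λ i j = 0
    · have hlim := (hP.tendsto_real_gridTransition hΛ hij.1 hij.2 M).comp tendsto_inv_succ_nhdsGT
      set U : ℕ → Set (CadlagPath I) := fun n => gridTransition i j (1 / ((n : ℝ≥0) + 1))
        ⌈(M : ℝ≥0) / (1 / ((n : ℝ≥0) + 1))⌉₊
      have hnull : ∀ N, P (⋂ n ≥ N, U n) = 0 := by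
        intro N
        rw [← measureReal_eq_zero_iff]
        refine le_antisymm (ge_of_tendsto hlim ?_) measureReal_nonneg
        filter_upwards [eventually_ge_atTop N] with n hn
        exact measureReal_mono (biInter_subset_of_mem (show n ∈ {n | n ≥ N} from hn))
      have : P (⋃ N, ⋂ n ≥ N, U n) = 0 := measure_iUnion_null hnull
      rw [ae_iff]
      refine measure_mono_null ?_ this
      intro ω hω
      simp only [Classical.not_imp, not_not, mem_ofPred_eq, eventually_atTop] at hω
      obtain ⟨-, -, N, hN⟩ := hω
      exact mem_iUnion.2 ⟨N, mem_iInter₂.2 hN⟩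
    · exact Eventually.of_forall fun ω h1 h2 => absurd ⟨h1, h2⟩ hij
  filter_upwards [key] with ω hω S S' hSS hc
  by_contra! hcon
  obtain ⟨M, hM⟩ := exists_nat_ge S'
  have hne : X S ω ≠ X S' ω := fun e => hcon.1 e.symm
  refine hω (X S ω) (X S' ω) M hne (le_antisymm hcon.2 (hΛ.off_diag_nonneg _ _ hne)) ?_
  exact tendsto_inv_succ_nhdsGT.eventually (eventually_mem_gridTransition hSS hM hc)

lemma IsChainLaw.ae_isRegularPath (hP : IsChainLaw Λ μ P) (hΛ : IsRateMatrix Λ) :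
    ∀ᵐ ω ∂P, IsRegularPath Λ μ.1 ω := by
  filter_upwards [hP.ae_init_pos, hP.ae_jump_pos hΛ] with ω h1 h2 using ⟨h1, h2⟩

end Regular

/-! ### Conditioning on the observations of a grid -/

section GridConditioning

/-- The conditional probability of an event given a random variable with finitely many values is
determined by the probabilities on its fibres. -/
lemma condExp_comap_finite {Ω T : Type*} [Finite T] {m0 : MeasurableSpace Ω} {P : Measure Ω}
    [IsFiniteMeasure P] {Z : Ω → T} (hZ : MeasurableSpace.comap Z ⊤ ≤ m0) {A : Set Ω}
    (hA : MeasurableSet A) (d : T → ℝ)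
    (hd : ∀ a, d a * P.real (Z ⁻¹' {a}) = P.real (Z ⁻¹' {a} ∩ A)) :
    P⟦A | MeasurableSpace.comap Z ⊤⟧ =ᵐ[P] fun ω => d (Z ω) := by
  have hm : ∀ B : Set T, MeasurableSet (Z ⁻¹' B) := fun B => hZ _ ⟨B, trivial, rfl⟩
  have hmeas : StronglyMeasurable[MeasurableSpace.comap Z ⊤] fun ω => d (Z ω) := by
    refine Measurable.stronglyMeasurable ?_
    rintro B -
    exact ⟨d ⁻¹' B, trivial, rfl⟩
  obtain ⟨C, hC⟩ := (Set.finite_range fun a => |d a|).bddAbove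
  have hint : Integrable (fun ω => d (Z ω)) P :=
    Integrable.of_bound (hmeas.mono hZ).aestronglyMeasurable C
      (Eventually.of_forall fun ω => hC ⟨Z ω, rfl⟩)
  refine (ae_eq_condExp_of_forall_setIntegral_eq hZ ((integrable_const (1 : ℝ)).indicator hA)
    (fun _ _ _ => hint.integrableOn) ?_ hmeas.aestronglyMeasurable).symm
  rintro _ ⟨B, -, rfl⟩ -
  have e : Z ⁻¹' B = ⋃ a ∈ B.toFinite.toFinset, Z ⁻¹' {a} := by
    ext ω
    simp
  have hdisj : (B.toFinite.toFinset : Set T).Pairwise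
      (Function.onFun Disjoint fun a => Z ⁻¹' {a}) := by
    intro a _ b _ hab
    exact Disjoint.preimage Z (disjoint_singleton.2 hab)
  rw [e, integral_biUnion_finset _ (fun a _ => hm {a}) hdisj fun _ _ => hint.integrableOn,
    integral_biUnion_finset _ (fun a _ => hm {a}) hdisj
      fun _ _ => ((integrable_const (1 : ℝ)).indicator hA).integrableOn]
  refine Finset.sum_congr rfl fun a _ => ?_
  rw [setIntegral_indicator hA, setIntegral_const, smul_eq_mul, mul_one, ← hd a,
    setIntegral_congr_fun (g := fun _ => d a) (hm {a}) (fun ω hω => by rw [show Z ω = a from hω]),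
    setIntegral_const, smul_eq_mul, mul_comm]

variable {I O : Type*}

/-- The observations of a path at the first `k + 1` points of the grid of mesh `δ`. -/
def gridObs (h : I → O) (δ : ℝ≥0) (k : ℕ) (ω : CadlagPath I) : Fin (k + 1) → O :=
  fun l => Y h ((l : ℕ) * δ) ω

lemma comap_gridObs_le [Finite O] (h : I → O) {δ t : ℝ≥0} {k : ℕ} (hk : k * δ ≤ t) :
    MeasurableSpace.comap (gridObs h δ k) ⊤ ≤ obsSigma h t := by
  rintro _ ⟨B, -, rfl⟩
  have e : gridObs h δ k ⁻¹' B = ⋃ a ∈ B, ⋂ l : Fin (k + 1), Y h ((l : ℕ) * δ) ⁻¹' {a l} := by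
    ext ω
    simp only [mem_preimage, mem_iUnion, mem_iInter, mem_singleton_iff, exists_prop]
    constructor
    · exact fun hω => ⟨_, hω, fun l => rfl⟩
    · rintro ⟨a, ha, hω⟩
      rwa [show gridObs h δ k ω = a from funext hω]
  rw [e]
  refine MeasurableSet.biUnion B.to_countable fun a _ => MeasurableSet.iInter fun l => ?_
  refine measurableSet_obsSigma h (le_trans ?_ hk) _
  exact mul_le_mul_left (Nat.cast_le.2 (Nat.lt_succ_iff.1 l.2)) δ

variable [Fintype I] [DecidableEq I] {Λ : Matrix I I ℝ} {μ : stdSimplex ℝ I}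
  {P : Measure (CadlagPath I)}

/-- The unnormalised grid filter is the joint law of the observations and the current state. -/
lemma IsChainLaw.real_obs_inter (hP : IsChainLaw Λ μ P) (h : I → O) (δ : ℝ≥0) (a : ℕ → O) (k : ℕ)
    (j : I) : P.real ((⋂ l ∈ Finset.range (k + 1), Y h (l * δ) ⁻¹' {a l}) ∩ X (k * δ) ⁻¹' {j}) =
      obsVec (NormedSpace.exp ((δ : ℝ) • Λ)) h μ.1 a k j := by
  have := hP.isProbabilityMeasure
  induction k generalizing j with
  | zero =>
    simp only [zero_add, Finset.range_one, Finset.set_biInter_singleton, Nat.cast_zero, zero_mul,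
      obsVec]
    by_cases hj : h j = a 0
    · rw [restr_apply_of_eq hj, ← hP.initial j]
      congr 1
      ext ω
      simp only [mem_inter_iff, mem_preimage, mem_singleton_iff, mem_ofPred_eq]
      exact ⟨fun hω => hω.2, fun hω => ⟨by rw [Y, hω, hj], hω⟩⟩
    · rw [restr_apply_of_ne hj]
      convert! measureReal_empty (μ := P)
      refine eq_empty_of_forall_notMem fun ω hω => hj ?_
      rw [← mem_singleton_iff.1 hω.2]
      exact hω.1
  | succ k ih =>
    rw [Finset.range_add_one, Finset.set_biInter_insert, obsVec]
    set D := ⋂ l ∈ Finset.range (k + 1), Y h (l * δ) ⁻¹' {a l} with hD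
    have hDm : MeasurableSet[chainSigma I (k * δ)] D := by
      refine Finset.measurableSet_biInter _ fun l hl => ?_
      have hlk : (l : ℝ≥0) ≤ k := Nat.cast_le.2 (by simpa [Nat.lt_succ_iff] using hl)
      exact measurableSet_chainSigma (mul_le_mul_left hlk δ) (h ⁻¹' {a l})
    have et : ((k + 1 : ℕ) : ℝ≥0) * δ = k * δ + δ := by push_cast; ring
    rw [et]
    by_cases hj : h j = a (k + 1)
    · have e : Y h (k * δ + δ) ⁻¹' {a (k + 1)} ∩ D ∩ X (k * δ + δ) ⁻¹' {j} =
          D ∩ X (k * δ + δ) ⁻¹' {j} := by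
        ext ω
        simp only [mem_inter_iff, mem_preimage, mem_singleton_iff]
        exact ⟨fun hω => ⟨hω.1.2, hω.2⟩, fun hω => ⟨⟨by rw [Y, hω.2, hj], hω.1⟩, hω.2⟩⟩
      rw [restr_apply_of_eq hj, e, ← sum_real_inter_X P (k * δ)]
      refine Finset.sum_congr rfl fun i _ => ?_
      rw [inter_right_comm, hP.real_inter_inter hDm, ih i]
    · rw [restr_apply_of_ne hj]
      convert! measureReal_empty (μ := P)
      refine eq_empty_of_forall_notMem fun ω hω => hj ?_
      rw [← mem_singleton_iff.1 hω.2]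
      exact hω.1.1

lemma IsChainLaw.condExp_gridObs [Finite O] (hP : IsChainLaw Λ μ P) (h : I → O) (δ : ℝ≥0) (k : ℕ)
    (j : I) : P⟦X (k * δ) ⁻¹' {j} | MeasurableSpace.comap (gridObs h δ k) ⊤⟧ =ᵐ[P]
      fun ω => gridFilter Λ h μ.1 ω δ k j := by
  have := hP.isProbabilityMeasure
  set E := NormedSpace.exp ((δ : ℝ) • Λ) with hE
  refine (condExp_comap_finite ((comap_gridObs_le h le_rfl).trans
    ((obsSigma_le_chainSigma h _).trans (chainSigma_le _))) (measurableSet_X_preimage _ {j})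
    (fun a => normMass (obsVec E h μ.1 (fun l => a (Fin.ofNat (k + 1) l)) k) j) fun a => ?_).trans
    (Eventually.of_forall fun ω => ?_)
  · set u := obsVec E h μ.1 (fun l => a (Fin.ofNat (k + 1) l)) k with hu
    have e : gridObs h δ k ⁻¹' {a} =
        ⋂ l ∈ Finset.range (k + 1), Y h (l * δ) ⁻¹' {a (Fin.ofNat (k + 1) l)} := by
      ext ω
      simp only [mem_preimage, mem_singleton_iff, mem_iInter, Finset.mem_range]
      constructor
      · rintro rfl l hl
        simp [gridObs, Nat.mod_eq_of_lt hl]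
      · intro hω
        ext l
        have := hω l l.2
        simpa [gridObs] using this
    have hjoint : ∀ i, P.real (gridObs h δ k ⁻¹' {a} ∩ X (k * δ) ⁻¹' {i}) = u i := fun i => by
      rw [e]
      exact hP.real_obs_inter h δ (fun l => a (Fin.ofNat (k + 1) l)) k i
    have hnn : ∀ i, 0 ≤ u i := fun i => by
      rw [← hjoint i]
      exact measureReal_nonneg
    rw [hjoint j, ← sum_real_inter_X P (k * δ)]
    simp only [hjoint]
    by_cases hs : ∑ i, u i = 0
    · rw [hs, mul_zero, (Finset.sum_eq_zero_iff_of_nonneg fun i _ => hnn i).1 hs j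
        (Finset.mem_univ j)]
    · rw [normMass, Pi.smul_apply, smul_eq_mul]
      field_simp
  · simp only [gridFilter]
    rw [obsVec_congr E h μ.1 (a' := fun l => Y h (l * δ) ω) fun l hl => ?_]
    simp [gridObs, Nat.mod_eq_of_lt (Nat.lt_succ_of_le hl)]

end GridConditioning

/-! ### Refining the grid -/

section Refine

variable {I O : Type*}

/-- The σ-algebra of the observations on the `n`-th dyadic subdivision of `[0, K τ]`, with mesh
`τ / 2 ^ n`. -/
@[reducible] noncomputable def dyadicSigma (h : I → O) (τ : ℝ≥0) (K n : ℕ) :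
    MeasurableSpace (CadlagPath I) :=
  MeasurableSpace.comap (gridObs h (τ / 2 ^ n) (K * 2 ^ n)) ⊤

lemma dyadicSigma_mono (h : I → O) (τ : ℝ≥0) (K : ℕ) : Monotone (dyadicSigma h τ K) := by
  refine monotone_nat_of_le_succ fun n => ?_
  have e : gridObs h (τ / 2 ^ n) (K * 2 ^ n) =
      (fun (a : Fin (K * 2 ^ (n + 1) + 1) → O) (l : Fin (K * 2 ^ n + 1)) =>
        a ⟨2 * l, by
          have h1 := l.2
          have h2 : K * 2 ^ (n + 1) = 2 * (K * 2 ^ n) := by ring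
          omega⟩) ∘
        gridObs h (τ / 2 ^ (n + 1)) (K * 2 ^ (n + 1)) := by
    ext ω l
    simp only [gridObs, Function.comp]
    congr 1
    push_cast
    rw [pow_succ]
    field_simp
  rw [dyadicSigma, e, ← MeasurableSpace.comap_comp]
  exact MeasurableSpace.comap_mono le_top

lemma dyadicSigma_le [Finite O] (h : I → O) (τ : ℝ≥0) (K n : ℕ) :
    dyadicSigma h τ K n ≤ obsSigma h (K * τ) := by
  refine comap_gridObs_le h (le_of_eq ?_)
  push_cast
  field_simp

lemma tendsto_div_two_pow {τ : ℝ≥0} (hτ : 0 < τ) :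
    Tendsto (fun n : ℕ => τ / 2 ^ n) atTop (𝓝[>] 0) := by
  refine tendsto_nhdsWithin_iff.2 ⟨?_, Eventually.of_forall fun n => ?_⟩
  · have h := (tendsto_pow_atTop_nhds_zero_of_lt_one (r := (2⁻¹ : ℝ≥0)) zero_le
      (by norm_num)).const_mul τ
    rw [mul_zero] at h
    refine h.congr fun n => ?_
    rw [inv_pow, div_eq_mul_inv]
  · simp only [mem_Ioi]
    positivity

/-- By right continuity, `Y_s` is the limit of its values at the grid points to the right of `s`. -/
lemma iSup_dyadicSigma [Finite O] (h : I → O) {τ : ℝ≥0} (hτ : 0 < τ) (K : ℕ) :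
    ⨆ n, dyadicSigma h τ K n = obsSigma h (K * τ) := by
  refine le_antisymm (iSup_le fun n => dyadicSigma_le h τ K n) (iSup₂_le fun s hs => ?_)
  rintro _ ⟨B, -, rfl⟩
  refine @measurableSet_of_tendsto_indicator _ (⨆ n, dyadicSigma h τ K n) _ ℕ atTop _
    (fun n => Y h (⌈s / (τ / 2 ^ n)⌉₊ * (τ / 2 ^ n)) ⁻¹' B) _ (fun n => ?_) fun ω => ?_
  · have hl : ⌈s / (τ / 2 ^ n)⌉₊ ≤ K * 2 ^ n := by
      rw [Nat.ceil_le, div_le_iff₀ (by positivity)]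
      refine hs.2.trans (le_of_eq ?_)
      push_cast
      field_simp
    refine le_iSup (dyadicSigma h τ K) n _ ⟨{a | a ⟨_, Nat.lt_succ_of_le hl⟩ ∈ B}, trivial, ?_⟩
    rfl
  · filter_upwards [(tendsto_div_two_pow hτ).eventually (eventually_Y_ceil h ω s)] with n hn
    rw [mem_preimage, mem_preimage, hn]

/-- The observations along the dyadic subdivisions of `[0, K τ]`, as a filtration. -/
noncomputable def dyadicFiltration [Finite O] (h : I → O) (τ : ℝ≥0) (K : ℕ) :
    Filtration ℕ (CadlagPath.instMeasurableSpace : MeasurableSpace (CadlagPath I)) where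
  seq := dyadicSigma h τ K
  mono' := dyadicSigma_mono h τ K
  le' n := (dyadicSigma_le h τ K n).trans ((obsSigma_le_chainSigma h _).trans (chainSigma_le _))

variable [Fintype I] [DecidableEq I] {Λ : Matrix I I ℝ} {μ : stdSimplex ℝ I}
  {P : Measure (CadlagPath I)}

/-- The case `t = K τ` of `IsChainLaw.condExp_X`. Taking `K = 0` and `τ = 1` covers `t = 0` with a
grid of positive mesh. -/
lemma IsChainLaw.condExp_X_mul [Finite O] (hP : IsChainLaw Λ μ P) (hΛ : IsRateMatrix Λ) (h : I → O)
    (ν : O → I → ℝ) {τ : ℝ≥0} (hτ : 0 < τ) (K : ℕ) (j : I) :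
    P⟦X (K * τ) ⁻¹' {j} | obsSigma h (K * τ)⟧ =ᵐ[P]
      fun ω => filteringProcess Λ h ν μ (K * τ) ω j := by
  have := hP.isProbabilityMeasure
  have h1 := tendsto_ae_condExp (μ := P) (ℱ := dyadicFiltration h τ K)
    ((X (K * τ) ⁻¹' {j}).indicator fun _ => (1 : ℝ))
  have e1 : ⨆ n, dyadicFiltration h τ K n = obsSigma h (K * τ) := iSup_dyadicSigma h hτ K
  rw [e1] at h1
  have hgrid : ∀ n : ℕ, ((K * 2 ^ n : ℕ) : ℝ≥0) * (τ / 2 ^ n) = K * τ := fun n => by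
    push_cast
    field_simp
  have h2 : ∀ᵐ ω ∂P, ∀ n, (P⟦X (K * τ) ⁻¹' {j} | dyadicFiltration h τ K n⟧) ω =
      gridFilter Λ h μ.1 ω (τ / 2 ^ n) (K * 2 ^ n) j := by
    refine ae_all_iff.2 fun n => ?_
    have := hP.condExp_gridObs h (τ / 2 ^ n) (K * 2 ^ n) j
    rw [hgrid] at this
    exact this
  filter_upwards [h1, h2, hP.ae_isRegularPath hΛ] with ω h1 h2 hω
  obtain ⟨p, hp, hlim⟩ := hω.exists_isFilterSolution (h := h) hΛ ν
  rw [hp.filteringProcess_eq]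
  refine tendsto_nhds_unique h1 ?_
  have h3 := tendsto_pi_nhds.1 ((hlim (K * τ)).comp (tendsto_div_two_pow hτ)) j
  refine h3.congr fun n => ?_
  have hceil : ⌈(K * τ) / (τ / 2 ^ n)⌉₊ = K * 2 ^ n := by
    have : (K * τ) / (τ / 2 ^ n) = ((K * 2 ^ n : ℕ) : ℝ≥0) := by
      push_cast
      field_simp
    rw [this, Nat.ceil_natCast]
  rw [h2 n, Function.comp_apply, hceil]

/-- The filtering process is the conditional law of the present state given the observations. -/
theorem IsChainLaw.condExp_X [Finite O] (hP : IsChainLaw Λ μ P) (hΛ : IsRateMatrix Λ) (h : I → O)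
    (ν : O → I → ℝ) (t : ℝ≥0) (j : I) :
    P⟦X t ⁻¹' {j} | obsSigma h t⟧ =ᵐ[P] fun ω => filteringProcess Λ h ν μ t ω j := by
  rcases eq_or_ne t 0 with rfl | ht
  · simpa using hP.condExp_X_mul hΛ h ν one_pos 0 j
  · simpa using hP.condExp_X_mul hΛ h ν (pos_iff_ne_zero.2 ht) 1 j

end Refine

theorem proposition3 {I O : Type*} [Fintype I] [DecidableEq I]
    (Λ : Matrix I I ℝ) (hΛ : IsRateMatrix Λ)
    (h : I → O) (hsurj : Function.Surjective h)
    (ν : O → I → ℝ) (hν : ∀ a, ν a ∈ stdSimplex ℝ I ∧ ∀ i, h i ≠ a → ν a i = 0)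
    (P : stdSimplex ℝ I → Measure (CadlagPath I)) (hP : ∀ μ, IsChainLaw Λ μ (P μ))
    (μ : stdSimplex ℝ I) (t : ℝ≥0) (Γ : Set (CadlagPath I)) (hΓ : MeasurableSet Γ) :
    (P μ)⟦CadlagPath.shift t ⁻¹' Γ | CadlagPath.obsSigma h t⟧ =ᵐ[P μ]
      fun ω => ∑ i, (P (diracPt i)).real Γ * filteringProcess Λ h ν μ t ω i := by
  have : Finite O := Finite.of_surjective h hsurj
  have h1 : ∀ᵐ ω ∂(P μ), ∀ i, ((P μ)⟦X t ⁻¹' {i} | obsSigma h t⟧) ω =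
      filteringProcess Λ h ν μ t ω i := ae_all_iff.2 fun i => (hP μ).condExp_X hΛ h ν t i
  filter_upwards [(hP μ).condExp_shift_obsSigma (fun i => hP (diracPt i)) h t hΓ, h1] with ω h2 h1
  rw [h2]
  exact Finset.sum_congr rfl fun i _ => by rw [h1 i]
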